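/- Let $k\ge 1$ and $I=\mathbb{Z}/(k+1)$. An affine permutation is a bijection $x:\mathbb{Z}\to\mathbb{Z}$ with $x(n+k+1)=x(n)+k+1$ and $\sum_{n=1}^{k+1}x(n)=\binom{k+2}{2}$; the generator $s_i$ ($i\in I$) exchanges $m(k+1)+i$ and $m(k+1)+i+1$ for all $m\in\mathbb{Z}$. Call $x$ $0$-dominant (Grassmannian) if $x(i)>x(i+1)$ only for $i\equiv 0 \pmod{k+1}$. For $A\subsetneq I$ let $d_A$ (resp. $u_A$) be the product of the $s_j$, $j\in A$, each occurring once, with $s_j$ to the left (resp. right) of $s_{j-1}$ whenever $j,j-1\in A$. A decreasing (resp. increasing) expression of $x$ is a length-additive product $x=d_{A_n}\cdots d_{A_1}$ (resp. $x=u_{A_n}\cdots u_{A_1}$) with nonempty $A_i\subsetneq I$; it is maximal if $(|A_1|,\dots,|A_n|)$ is lexicographically maximal among all such expressions of $x$. A $k$-code is a function $\alpha:I\to\mathbb{Z}_{\ge0}$ with at least one zero. We write $\operatorname{RD}(x)=\alpha$ if $x$ has exactly one maximal decreasing expression and it is given by $A_{j+1}=\{i-j : i\in I,\ \alpha_i>j\}$,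 $0\le j<\max\alpha$; and $\operatorname{RI}(x)=\beta$ if $x$ has exactly one maximal increasing expression and it is given by $A_{j+1}=\{i+j: i\in I,\ \beta_i>j\}$, $0\le j<\max\beta$. A partition is $k$-bounded if all its parts are at most $k$, and is a $(k+1)$-core if it has no hook of length $k+1$. For a $(k+1)$-core $c$, let $\mathfrak p(c)$ be the $k$-bounded partition obtained by deleting all boxes of hook length greater than $k+1$ and left-justifying the rows; $\mathfrak p$ is a bijection from $(k+1)$-cores to $k$-bounded partitions, with inverse $\mathfrak c$. The $k$-conjugate of $\lambda$ is $\lambda^{(k)}=\mathfrak p(\mathfrak c(\lambda)^t)$, where $t$ denotes the usual conjugate. A $0$-dominant $x$ is associated to the $k$-bounded partition $\lambda$ if $c=\mathfrak c(\lambda)$ satisfies $x(\mathbb{Z}_{\le 0})=\{c_i-i+1 : i\ge1\}$ (with $c_i=0$ for large $i$); this is the usual correspondence between Grassmannian affine permutations, $(k+1)$-cores and $k$-bounded partitions. **Proposition.** Let $x$ be a $0$-dominant affine permutation. Then $x$ is associated to exactly one $k$-bounded partition $\lambda$, and $\lambda$ has exactly one $k$-conjugate $\nu=\lambda^{(k)}$.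 Let $(\lambda_1',\dots,\lambda_k')$ and $(\nu_1',\dots,\nu_k')$ be the column heights of $\lambda$ and $\nu$ (some may be zero). Then $\operatorname{RD}(x)=\alpha$ with $$(\alpha_0,\alpha_1,\dots,\alpha_{k})=(\lambda_1',\dots,\lambda_k',0),$$ and $\operatorname{RI}(x)=\beta$ with $$(\beta_0,\beta_{-1},\dots,\beta_{-k})=(\nu_1',\dots,\nu_k',0),$$ indices being taken modulo $k+1$. So the usual $k$-conjugation is the switch between the two maximal decompositions. -/

import Mathlib

namespace AffineCode

/-! ### Affine permutations -/

/-- Affine permutations of period `k + 1`: bijections `x` of `ℤ` with `x (n + k + 1) = x n + k + 1`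
and `x 1 + ⋯ + x (k + 1) = (k + 2 choose 2)`. -/
def IsAffinePerm (k : ℕ) (x : Equiv.Perm ℤ) : Prop :=
  (∀ n : ℤ, x (n + (k + 1)) = x n + (k + 1)) ∧
    ∑ n ∈ Finset.Icc (1 : ℤ) (k + 1), x n = ((k + 2).choose 2 : ℤ)

/-- The map exchanging `m (k + 1) + i` and `m (k + 1) + i + 1` for every integer `m`. -/
def simpleFun (k : ℕ) (i : ZMod (k + 1)) (n : ℤ) : ℤ :=
  if (n : ZMod (k + 1)) = i then n + 1 else if (n : ZMod (k + 1)) = i + 1 then n - 1 else n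

theorem simpleFun_involutive (k : ℕ) [NeZero k] (i : ZMod (k + 1)) :
    Function.Involutive (simpleFun k i) := by
  have : Fact (1 < k + 1) := ⟨by have := NeZero.pos k; omega⟩
  have h1 : (1 : ZMod (k + 1)) ≠ 0 := one_ne_zero
  intro n
  unfold simpleFun
  by_cases h : (n : ZMod (k + 1)) = i
  · simp [h, h1]
  · by_cases h' : (n : ZMod (k + 1)) = i + 1
    · simp [h', h1]
    · simp [h, h']

/-- The simple generator `s_i`, `i ∈ ℤ/(k+1)`. -/
def simple (k : ℕ) [NeZero k] (i : ZMod (k + 1)) : Equiv.Perm ℤ :=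
  (simpleFun_involutive k i).toPerm

/-- `s_{w₁} s_{w₂} ⋯ s_{w_l}`; multiplication is composition of maps, so that right multiplication
by `s_i` acts on positions and left multiplication acts on values. -/
def wordProd (k : ℕ) [NeZero k] (w : List (ZMod (k + 1))) : Equiv.Perm ℤ :=
  (w.map (simple k)).prod

/-- `w` is a reduced word for `x`: it evaluates to `x` and no shorter word does.
Equivalently, the product `a_{w₁} ⋯ a_{w_l}` in the affine nil-Coxeter monoid is the nonzero
element corresponding to `x`. -/
def IsReducedWord (k : ℕ) [NeZero k] (x : Equiv.Perm ℤ) (w : List (ZMod (k + 1))) : Prop :=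
  wordProd k w = x ∧ ∀ w' : List (ZMod (k + 1)), wordProd k w' = x → w.length ≤ w'.length

/-- The right descent set: all `i` modulo `k + 1` with `x i > x (i + 1)`. -/
def rightDescents (k : ℕ) (x : Equiv.Perm ℤ) : Set (ZMod (k + 1)) :=
  {i | ∃ n : ℤ, (n : ZMod (k + 1)) = i ∧ x (n + 1) < x n}

/-- `x` is `p`-dominant if it has no right descent other than `p`. -/
def IsDominant (k : ℕ) (p : ZMod (k + 1)) (x : Equiv.Perm ℤ) : Prop :=
  rightDescents k x ⊆ {p}

/-! ### Cyclically decreasing and increasing decompositions -/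

/-- `w` is a word for `d_A`: every element of `A` occurs exactly once, and `j` stands to the left of
`j - 1` whenever both lie in `A`. -/
def IsDecWord (k : ℕ) (A : Finset (ZMod (k + 1))) (w : List (ZMod (k + 1))) : Prop :=
  w.Nodup ∧ w.toFinset = A ∧ ∀ j, j ∈ A → j - 1 ∈ A → w.idxOf j < w.idxOf (j - 1)

/-- `w` is a word for `u_A`: every element of `A` occurs exactly once, and `j` stands to the right
of `j - 1` whenever both lie in `A`. -/
def IsIncWord (k : ℕ) (A : Finset (ZMod (k + 1))) (w : List (ZMod (k + 1))) : Prop :=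
  w.Nodup ∧ w.toFinset = A ∧ ∀ j, j ∈ A → j - 1 ∈ A → w.idxOf (j - 1) < w.idxOf j

/-- `x = d_{A_n} ⋯ d_{A_2} d_{A_1}` in the nil-Coxeter monoid (so the product is reduced), where
`A = [A_1, A_2, …, A_n]` and the `A_i` are nonempty proper subsets of `ℤ/(k+1)`. -/
def IsDecExpr (k : ℕ) [NeZero k] (x : Equiv.Perm ℤ) (A : List (Finset (ZMod (k + 1)))) : Prop :=
  (∀ S ∈ A, S.Nonempty ∧ S ≠ Finset.univ) ∧
    ∃ ws : List (List (ZMod (k + 1))),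
      List.Forall₂ (IsDecWord k) A ws ∧ IsReducedWord k x ws.reverse.flatten

/-- `x = u_{A_n} ⋯ u_{A_2} u_{A_1}` in the nil-Coxeter monoid, where `A = [A_1, A_2, …, A_n]`
and the `A_i` are nonempty proper subsets of `ℤ/(k+1)`. -/
def IsIncExpr (k : ℕ) [NeZero k] (x : Equiv.Perm ℤ) (A : List (Finset (ZMod (k + 1)))) : Prop :=
  (∀ S ∈ A, S.Nonempty ∧ S ≠ Finset.univ) ∧
    ∃ ws : List (List (ZMod (k + 1))),
      List.Forall₂ (IsIncWord k) A ws ∧ IsReducedWord k x ws.reverse.flatten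

/-- The shape `(|A_1|, …, |A_n|)`. -/
def shape {k : ℕ} (A : List (Finset (ZMod (k + 1)))) : List ℕ :=
  A.map Finset.card

/-- A maximal decreasing expression for `x`: its shape is lexicographically maximal
(`≤` on lists is the lexicographic order). -/
def IsMaxDecExpr (k : ℕ) [NeZero k] (x : Equiv.Perm ℤ) (A : List (Finset (ZMod (k + 1)))) : Prop :=
  IsDecExpr k x A ∧ ∀ B, IsDecExpr k x B → shape B ≤ shape A

/-- A maximal increasing expression for `x`. -/
def IsMaxIncExpr (k : ℕ) [NeZero k] (x : Equiv.Perm ℤ) (A : List (Finset (ZMod (k + 1)))) : Prop :=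
  IsIncExpr k x A ∧ ∀ B, IsIncExpr k x B → shape B ≤ shape A

/-! ### `k`-codes -/

/-- A `k`-code: a function `ℤ/(k+1) → ℕ` with at least one zero. -/
def IsCode (k : ℕ) (α : ZMod (k + 1) → ℕ) : Prop :=
  ∃ i, α i = 0

/-- The rows of the filling of a code `α` for decreasing decompositions. Column `i` has `α i` boxes,
filled from the first row on with the residues `i, i - 1, i - 2, …`; hence row `j` (counted
from `0`) is `{i - j | j < α i}`. -/
def decRows (k : ℕ) (α : ZMod (k + 1) → ℕ) : List (Finset (ZMod (k + 1))) :=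
  (List.range (Finset.univ.sup α)).map fun j =>
    (Finset.univ.filter fun i => j < α i).image fun i => i - (j : ZMod (k + 1))

/-- The analogous sets for increasing decompositions: here the strip of `i` has `β i` boxes,
filled with the residues `i, i + 1, i + 2, …`. -/
def incRows (k : ℕ) (β : ZMod (k + 1) → ℕ) : List (Finset (ZMod (k + 1))) :=
  (List.range (Finset.univ.sup β)).map fun j =>
    (Finset.univ.filter fun i => j < β i).image fun i => i + (j : ZMod (k + 1))

/-- `RD(x) = α`: `x` has exactly one maximal decreasing expression, and its sets are the rows of the
filling of the code `α`. -/
def IsRD (k : ℕ) [NeZero k] (x : Equiv.Perm ℤ) (α : ZMod (k + 1) → ℕ) : Prop :=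
  IsCode k α ∧ ∀ A, IsMaxDecExpr k x A ↔ A = decRows k α

/-- `RI(x) = β`: `x` has exactly one maximal increasing expression, and its sets are those of the
filling of the code `β`. The value `β i` belongs to the strip whose first box has residue `i`. -/
def IsRI (k : ℕ) [NeZero k] (x : Equiv.Perm ℤ) (β : ZMod (k + 1) → ℕ) : Prop :=
  IsCode k β ∧ ∀ A, IsMaxIncExpr k x A ↔ A = incRows k β

/-- The function on `ℤ/(k+1)` whose values at `0, 1, …, k` are
`(h_1, …, h_k, 0)`, where `h_1, …, h_k` are the heights of the first `k` columns of the diagram. -/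
def colCode (k : ℕ) (lam : YoungDiagram) (i : ZMod (k + 1)) : ℕ :=
  if i.val < k then lam.colLen i.val else 0

/-! ### Bounded partitions and cores

Partitions are Young diagrams; `rowLen i` and `colLen j` are the row lengths and column heights,
indexed from `0`. -/

/-- All parts are at most `k`. -/
def IsBounded (k : ℕ) (lam : YoungDiagram) : Prop :=
  ∀ i, lam.rowLen i ≤ k

/-- The hook length (arm + leg + 1) of a box `(i, j)` of the diagram. -/
def hook (c : YoungDiagram) (b : ℕ × ℕ) : ℕ :=
  (c.rowLen b.1 - (b.2 + 1)) + (c.colLen b.2 - (b.1 + 1)) + 1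

/-- A `(k+1)`-core: no hook has length `k + 1`. -/
def IsCore (k : ℕ) (c : YoungDiagram) : Prop :=
  ∀ b ∈ c.cells, hook c b ≠ k + 1

/-- `lam = 𝔭(c)`, i.e. `c` is a `(k+1)`-core with `c = 𝔠(lam)`: the rows of `lam` are
obtained from those of `c` by deleting all boxes with hook length greater than `k + 1`. -/
def IsCoreOf (k : ℕ) (c lam : YoungDiagram) : Prop :=
  IsCore k c ∧ ∀ i, lam.rowLen i = (c.cells.filter fun b => b.1 = i ∧ hook c b ≤ k + 1).card

/-- `nu` is the `k`-conjugate of `lam`: `nu = 𝔭(𝔠(lam)ᵗ)`. -/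
def IsKConjugate (k : ℕ) (lam nu : YoungDiagram) : Prop :=
  ∃ c, IsCoreOf k c lam ∧ IsCoreOf k c.transpose nu

/-- The standard correspondence between Grassmannian affine permutations and `(k+1)`-cores
`c = (c_0 ≥ c_1 ≥ …)`: the bead set `{c_i - i | i ≥ 0}` of `c` is the image under `x` of the
bead set `{0, -1, -2, …}` of the empty core. Left multiplication of `x` by `s_i` moves beads between
positions `≡ i` and `≡ i + 1`, that is, adds or removes the boxes of residue `i`. -/
def IsCoreOfPerm (x : Equiv.Perm ℤ) (c : YoungDiagram) : Prop :=
  x '' Set.Iic 0 = Set.range fun i : ℕ => (c.rowLen i : ℤ) - i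

/-- The affine permutation `x` is associated to the bounded partition `lam`: the core of `x`
is `𝔠(lam)`. -/
def IsAssociated (k : ℕ) (x : Equiv.Perm ℤ) (lam : YoungDiagram) : Prop :=
  ∃ c, IsCoreOf k c lam ∧ IsCoreOfPerm x c

end AffineCode

/-! The argument is carried by the inversion code of a periodic permutation: to each residue `r`
attach the number of positions left of `r` that carry a larger value. Its total `len` is the Coxeter
length. Right multiplication by `s_i` at a descent swaps the entries at `i` and `i + 1` and lowers
the one moved to `i` by one; everything about decompositions follows from this rule.

Suppose `x = y d_A` is length-additive. By `invCode_of_mul_decWord` the code of `x` is positive at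
`r + 1` for every `r ∈ A`, so `A` lies in the support of `decCode k x`, the code shifted by one.
Conversely the whole support can be removed at once (`len_mul_firstRow`), because each of its runs
starts at a record, and what remains has the code with its first row deleted
(`decCode_eq_tailCode`). Any other first set is strictly smaller, so the greedy choice is the unique
lexicographic maximum: `RD(x)` is `decCode k x` for every affine permutation (`isRD_decCode`).

For `0`-dominant `x`, encode the core by its beads `x(p)`, `p ≤ 0`. Hook lengths are differences of
beads and gaps, so row `j` of the bounded partition counts the gaps among the `k + 1` integers below
bead `j`, equivalently the window values `x(1) < ⋯ < x(k + 1)` lying below that bead. Reading this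
count by columns, column `i` (counted from `0`) has as many boxes as there are beads above `x(i +
1)`, and that is the inversion count at `i + 1` (`decCode_eq_colCode`).

Increasing expressions need no second argument. Conjugation by `n ↦ 1 - n` sends `s_i` to `s_{-i}`,
exchanges `d` and `u`, preserves `0`-dominance and transposes the core, so `RI(x)` is `RD` of the
conjugate with negated indices, and the conjugate core yields the `k`-conjugate. -/

namespace AffineCode

/-! ### Periodic permutations and their inversion counts -/

/-- Commutation with the translation by `k + 1`. -/
def IsPeriodic (k : ℕ) (x : Equiv.Perm ℤ) : Prop :=
  ∀ n : ℤ, x (n + (k + 1)) = x n + (k + 1)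

theorem eq_of_periodic {β : Type*} {k : ℕ} {g : ℤ → β} (hg : ∀ n, g (n + (k + 1)) = g n)
    {m n : ℤ} (h : (m : ZMod (k + 1)) = n) : g m = g n := by
  obtain ⟨t, ht⟩ := (ZMod.intCast_eq_intCast_iff_dvd_sub m n (k + 1)).1 h
  have hp : Function.Periodic g ((k : ℤ) + 1) := hg
  have := hp.int_mul t m
  rw [← this]
  have ht' : (t : ℤ) * (k + 1) = n - m := by rw [ht]; push_cast; ring
  rw [Int.cast_id, ht', add_sub_cancel]

/-- The number of positions to the left of `q` that carry a larger value. -/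
noncomputable def invCount (x : Equiv.Perm ℤ) (q : ℤ) : ℕ :=
  {p | p < q ∧ x q < x p}.ncard

/-- The inversion counts of a periodic permutation, as a function of the residue class. -/
noncomputable def invCode (k : ℕ) (x : Equiv.Perm ℤ) (r : ZMod (k + 1)) : ℕ :=
  invCount x (r.val : ℤ)

/-- The displacements `x n - n` of a periodic permutation, as a function of the residue class. -/
def disp (k : ℕ) (x : Equiv.Perm ℤ) (r : ZMod (k + 1)) : ℤ :=
  x (r.val : ℤ) - (r.val : ℤ)

/-- The Coxeter length of a periodic permutation. -/
noncomputable def len (k : ℕ) (x : Equiv.Perm ℤ) : ℕ :=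
  ∑ r, invCode k x r

theorem disp_intCast {k : ℕ} {x : Equiv.Perm ℤ} (hx : IsPeriodic k x) (n : ℤ) :
    disp k x (n : ZMod (k + 1)) = x n - n := by
  refine eq_of_periodic (k := k) (g := fun n : ℤ => x n - n) (fun n => ?_) (by simp)
  have := hx n
  omega

theorem invCount_periodic {k : ℕ} {x : Equiv.Perm ℤ} (hx : IsPeriodic k x) (n : ℤ) :
    invCount x (n + (k + 1)) = invCount x n := by
  unfold invCount
  conv_rhs => rw [← Set.ncard_image_of_injective _ (add_left_injective ((k : ℤ) + 1))]
  congr 1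
  ext p
  constructor
  · rintro ⟨h1, h2⟩
    refine ⟨p - (k + 1), ⟨by omega, ?_⟩, by simp⟩
    have h3 := hx (p - (k + 1))
    rw [sub_add_cancel] at h3
    have := hx n
    omega
  · rintro ⟨q, ⟨h1, h2⟩, rfl⟩
    have h3 := hx q
    have h4 := hx n
    refine ⟨by simp only; omega, ?_⟩
    simp only
    omega

theorem invCode_intCast {k : ℕ} {x : Equiv.Perm ℤ} (hx : IsPeriodic k x) (n : ℤ) :
    invCode k x (n : ZMod (k + 1)) = invCount x n :=
  eq_of_periodic (invCount_periodic hx) (by simp)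

theorem exists_disp_bound {k : ℕ} {x : Equiv.Perm ℤ} (hx : IsPeriodic k x) :
    ∃ C : ℤ, ∀ n, |x n - n| ≤ C := by
  refine ⟨∑ r, |disp k x r|, fun n => ?_⟩
  rw [← disp_intCast hx]
  exact Finset.single_le_sum (f := fun r => |disp k x r|) (fun r _ => abs_nonneg _)
    (Finset.mem_univ _)

theorem finite_inversions {k : ℕ} {x : Equiv.Perm ℤ} (hx : IsPeriodic k x) (q v : ℤ) :
    {p | p < q ∧ v < x p}.Finite := by
  obtain ⟨C, hC⟩ := exists_disp_bound hx
  refine (Set.finite_Icc (v - C) q).subset fun p ⟨h1, h2⟩ => ?_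
  have := abs_le.1 (hC p)
  exact ⟨by omega, by omega⟩

theorem invCount_eq_zero {k : ℕ} {x : Equiv.Perm ℤ} (hx : IsPeriodic k x) {q : ℤ} :
    invCount x q = 0 ↔ ∀ p < q, x p < x q := by
  rw [invCount, Set.ncard_eq_zero (finite_inversions hx q (x q)), Set.eq_empty_iff_forall_notMem]
  refine forall_congr' fun p => ?_
  simp only [Set.mem_ofPred_eq, not_and, not_lt]
  refine forall_congr' fun hp => ⟨fun h => lt_of_le_of_ne h fun h' => ?_, le_of_lt⟩
  exact hp.ne (x.injective h')

/-- A position of maximal displacement is a record: `x p - p ≤ x r - r` and `p < r` force `x p < x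
r`. -/
theorem exists_invCode_eq_zero {k : ℕ} {x : Equiv.Perm ℤ} (hx : IsPeriodic k x) :
    ∃ r, invCode k x r = 0 := by
  obtain ⟨r, hr⟩ := Finite.exists_max (disp k x)
  refine ⟨r, (invCount_eq_zero hx).2 fun p hp => ?_⟩
  have := hr p
  rw [disp_intCast hx, disp] at this
  omega

theorem sum_zmod_eq_sum_Icc {β : Type*} [AddCommMonoid β] (k : ℕ) {g : ℤ → β}
    (hg : ∀ n, g (n + (k + 1)) = g n) :
    ∑ r : ZMod (k + 1), g (r.val : ℤ) = ∑ n ∈ Finset.Icc (1 : ℤ) (k + 1), g n := by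
  symm
  refine Finset.sum_bij (fun n _ => (n : ZMod (k + 1))) (fun _ _ => Finset.mem_univ _) ?_ ?_ ?_
  · intro m hm n hn h
    rw [Finset.mem_Icc] at hm hn
    obtain ⟨t, ht⟩ := (ZMod.intCast_eq_intCast_iff_dvd_sub m n (k + 1)).1 h
    push_cast at ht
    have h1 : t < 1 := by nlinarith
    have h2 : -1 < t := by nlinarith
    obtain rfl : t = 0 := by omega
    omega
  · intro r _
    by_cases h : r.val = 0
    · refine ⟨k + 1, by simp, ?_⟩
      have := ZMod.natCast_self (k + 1)
      push_cast at this ⊢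
      rw [this, eq_comm, ← ZMod.val_eq_zero, h]
    · have := ZMod.val_lt r
      exact ⟨r.val, Finset.mem_Icc.2 ⟨by omega, by omega⟩, by simp⟩
  · intro n _
    exact eq_of_periodic hg (by simp)

theorem sum_Icc_eq_choose (k : ℕ) :
    ∑ n ∈ Finset.Icc (1 : ℤ) (k + 1), n = ((k + 2).choose 2 : ℤ) := by
  induction k with
  | zero => simp
  | succ k ih =>
    have : Finset.Icc (1 : ℤ) ((k + 1 : ℕ) + 1) = 
        insert ((k : ℤ) + 2) (Finset.Icc (1 : ℤ) (k + 1)) := by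
      ext n
      simp only [Finset.mem_Icc, Finset.mem_insert]
      omega
    rw [this, Finset.sum_insert (by simp), ih, Nat.choose_succ_succ' (k + 2) 1, Nat.choose_one_right]
    push_cast
    ring

/-! ### Multiplication by a generator -/

theorem IsPeriodic.mul {k : ℕ} {x y : Equiv.Perm ℤ} (hx : IsPeriodic k x) (hy : IsPeriodic k y) :
    IsPeriodic k (x * y) := by
  intro n
  rw [Equiv.Perm.mul_apply, hy, hx, Equiv.Perm.mul_apply]

theorem isPeriodic_one {k : ℕ} : IsPeriodic k 1 := fun _ => rfl

/-- `i` is a right descent of the periodic permutation `x`. -/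
def IsDescent (k : ℕ) (x : Equiv.Perm ℤ) (i : ZMod (k + 1)) : Prop :=
  x ((i.val : ℤ) + 1) < x (i.val : ℤ)

theorem isDescent_intCast {k : ℕ} {x : Equiv.Perm ℤ} (hx : IsPeriodic k x) (n : ℤ) :
    IsDescent k x (n : ZMod (k + 1)) ↔ x (n + 1) < x n := by
  refine iff_of_eq (eq_of_periodic (k := k) (g := fun n : ℤ => x (n + 1) < x n)
    (fun n => ?_) (by simp))
  have h1 := hx n
  have h2 := hx (n + 1)
  rw [add_right_comm] at h2
  simp only [h1, h2, add_lt_add_iff_right]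

theorem len_one {k : ℕ} : len k 1 = 0 := by
  refine Finset.sum_eq_zero fun r _ => ?_
  exact (invCount_eq_zero (isPeriodic_one (k := k))).2 fun p hp => hp

/-- The sum condition becomes zero total displacement. Displacements depend only on residues, so
their sum can be reindexed along swaps and reflections. -/
theorem isAffinePerm_iff {k : ℕ} {x : Equiv.Perm ℤ} :
    IsAffinePerm k x ↔ IsPeriodic k x ∧ ∑ r, disp k x r = 0 := by
  refine and_congr_right fun hx => ?_
  have h1 : ∑ r : ZMod (k + 1), (x (r.val : ℤ) - (r.val : ℤ)) =
      ∑ n ∈ Finset.Icc (1 : ℤ) (k + 1), (x n - n) :=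
    sum_zmod_eq_sum_Icc k (g := fun n : ℤ => x n - n) fun n => by
      have := hx n
      omega
  rw [Finset.sum_sub_distrib (s := Finset.Icc _ _), sum_Icc_eq_choose] at h1
  change _ ↔ ∑ r : ZMod (k + 1), (x (r.val : ℤ) - (r.val : ℤ)) = 0
  rw [h1, sub_eq_zero]

theorem setOf_lt_add_one (f : ℤ → ℤ) (n v : ℤ) : {p | p < n + 1 ∧ v < f p} =
    if v < f n then insert n {p | p < n ∧ v < f p} else {p | p < n ∧ v < f p} := by
  split_ifs with h
  · ext p
    simp only [Set.mem_ofPred_eq, Set.mem_insert_iff, Int.lt_add_one_iff, le_iff_lt_or_eq]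
    constructor
    · rintro ⟨h1 | rfl, h2⟩
      exacts [Or.inr ⟨h1, h2⟩, Or.inl rfl]
    · rintro (rfl | ⟨h1, h2⟩)
      exacts [⟨Or.inr rfl, h⟩, ⟨Or.inl h1, h2⟩]
  · ext p
    simp only [Set.mem_ofPred_eq, Int.lt_add_one_iff, le_iff_lt_or_eq]
    constructor
    · rintro ⟨h1 | rfl, h2⟩
      exacts [⟨h1, h2⟩, absurd h2 h]
    · rintro ⟨h1, h2⟩
      exact ⟨Or.inl h1, h2⟩

section
variable {k : ℕ} [NeZero k]

theorem one_ne_zero_zmod : (1 : ZMod (k + 1)) ≠ 0 := by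
  have : Fact (1 < k + 1) := ⟨by have := NeZero.pos k; omega⟩
  exact one_ne_zero

theorem simple_apply (i : ZMod (k + 1)) (n : ℤ) : simple k i n =
    if (n : ZMod (k + 1)) = i then n + 1 else if (n : ZMod (k + 1)) = i + 1 then n - 1 else n :=
  rfl

theorem simple_apply_left {i : ZMod (k + 1)} {n : ℤ} (h : (n : ZMod (k + 1)) = i) :
    simple k i n = n + 1 := by
  rw [simple_apply, if_pos h]

theorem simple_apply_right {i : ZMod (k + 1)} {n : ℤ} (h : (n : ZMod (k + 1)) = i) :
    simple k i (n + 1) = n := by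
  have := one_ne_zero_zmod (k := k)
  rw [simple_apply, if_neg (by simp [h, this]), if_pos (by simp [h])]
  ring

theorem simple_apply_of_ne {i : ZMod (k + 1)} {n : ℤ} (h : (n : ZMod (k + 1)) ≠ i)
    (h' : (n : ZMod (k + 1)) ≠ i + 1) : simple k i n = n := by
  rw [simple_apply, if_neg h, if_neg h']

theorem simple_mul_self (i : ZMod (k + 1)) : simple k i * simple k i = 1 := by
  ext n
  exact simpleFun_involutive k i n

theorem isPeriodic_simple (i : ZMod (k + 1)) : IsPeriodic k (simple k i) := by
  intro n
  have : ((n + (k + 1) : ℤ) : ZMod (k + 1)) = n := by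
    have := ZMod.natCast_self (k + 1)
    push_cast at this ⊢
    rw [this, add_zero]
  simp only [simple_apply, this]
  split_ifs <;> ring

theorem simple_lt_iff {i : ZMod (k + 1)} {q : ℤ} (hq : (q : ZMod (k + 1)) ≠ i + 1) (p : ℤ) :
    simple k i p < q ↔ p < q := by
  rw [simple_apply]
  split_ifs with h1 h2
  · have : q ≠ p + 1 := by rintro rfl; simp [h1] at hq
    omega
  · have : q ≠ p := by rintro rfl; exact hq h2
    omega
  · rfl

/-- When `q` is not congruent to `i + 1`, no exchanged pair straddles the cut before `q`, so `s_i`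
permutes the positions left of `q`. -/
theorem ncard_mul_simple (x : Equiv.Perm ℤ) {i : ZMod (k + 1)} {q : ℤ}
    (hq : (q : ZMod (k + 1)) ≠ i + 1) (v : ℤ) :
    {p | p < q ∧ v < (x * simple k i) p}.ncard = {p | p < q ∧ v < x p}.ncard := by
  rw [← Set.ncard_image_of_injective _ (simple k i).injective]
  congr 1
  ext p
  constructor
  · rintro ⟨p, ⟨h1, h2⟩, rfl⟩
    exact ⟨(simple_lt_iff hq p).2 h1, h2⟩
  · rintro ⟨h1, h2⟩
    have h := simpleFun_involutive k i p
    refine ⟨simple k i p, ⟨(simple_lt_iff hq p).2 h1, ?_⟩, h⟩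
    rw [Equiv.Perm.mul_apply]
    exact h2.trans_eq (congrArg x h.symm)

theorem ne_add_one_zmod (i : ZMod (k + 1)) : i ≠ i + 1 := by
  simpa using (one_ne_zero_zmod (k := k))

theorem invCount_mul_simple_of_ne (x : Equiv.Perm ℤ) {i : ZMod (k + 1)} {q : ℤ}
    (h : (q : ZMod (k + 1)) ≠ i) (h' : (q : ZMod (k + 1)) ≠ i + 1) :
    invCount (x * simple k i) q = invCount x q := by
  rw [invCount, ncard_mul_simple x h', Equiv.Perm.mul_apply, simple_apply_of_ne h h', invCount]

/-- The value `x (n + 1)` moves to position `n` and loses exactly one inversion, the one with `x n`.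
-/
theorem invCount_mul_simple_left {x : Equiv.Perm ℤ} (hx : IsPeriodic k x) {n : ℤ}
    (h : x (n + 1) < x n) :
    invCount (x * simple k (n : ZMod (k + 1))) n + 1 = invCount x (n + 1) := by
  rw [invCount, ncard_mul_simple x (ne_add_one_zmod _), Equiv.Perm.mul_apply,
    simple_apply_left rfl, invCount, setOf_lt_add_one, if_pos h,
    Set.ncard_insert_of_notMem (by simp) (finite_inversions hx _ _)]

theorem invCount_mul_simple_right (x : Equiv.Perm ℤ) {n : ℤ} (h : x (n + 1) < x n) :
    invCount (x * simple k (n : ZMod (k + 1))) (n + 1) = invCount x n := by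
  have h1 : (x * simple k (n : ZMod (k + 1))) n = x (n + 1) := by
    rw [Equiv.Perm.mul_apply, simple_apply_left rfl]
  have h2 : (x * simple k (n : ZMod (k + 1))) (n + 1) = x n := by
    rw [Equiv.Perm.mul_apply, simple_apply_right rfl]
  rw [invCount, setOf_lt_add_one, h1, h2, if_neg h.not_gt, ncard_mul_simple x (ne_add_one_zmod _),
    invCount]

theorem invCode_mul_simple_of_ne {x : Equiv.Perm ℤ} (hx : IsPeriodic k x) {i r : ZMod (k + 1)}
    (h : r ≠ i) (h' : r ≠ i + 1) : invCode k (x * simple k i) r = invCode k x r := by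
  obtain ⟨n, rfl⟩ := ZMod.intCast_surjective r
  rw [invCode_intCast hx, invCode_intCast (hx.mul (isPeriodic_simple i)),
    invCount_mul_simple_of_ne x h h']

theorem invCode_mul_simple_left {x : Equiv.Perm ℤ} (hx : IsPeriodic k x) {i : ZMod (k + 1)}
    (h : IsDescent k x i) : invCode k (x * simple k i) i + 1 = invCode k x (i + 1) := by
  obtain ⟨n, rfl⟩ := ZMod.intCast_surjective i
  rw [isDescent_intCast hx] at h
  rw [invCode_intCast (hx.mul (isPeriodic_simple _)), invCount_mul_simple_left hx h,
    ← invCode_intCast hx]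
  simp

theorem invCode_mul_simple_right {x : Equiv.Perm ℤ} (hx : IsPeriodic k x) {i : ZMod (k + 1)}
    (h : IsDescent k x i) : invCode k (x * simple k i) (i + 1) = invCode k x i := by
  obtain ⟨n, rfl⟩ := ZMod.intCast_surjective i
  rw [isDescent_intCast hx] at h
  rw [invCode_intCast hx, ← invCount_mul_simple_right (k := k) x h,
    ← invCode_intCast (hx.mul (isPeriodic_simple (n : ZMod (k + 1))))]
  simp

theorem len_mul_simple_of_isDescent {x : Equiv.Perm ℤ} (hx : IsPeriodic k x) {i : ZMod (k + 1)}
    (h : IsDescent k x i) : len k (x * simple k i) + 1 = len k x := by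
  -- One identity covering all residues: the new code plus the indicator of `i` is the old code
  -- permuted by the swap, so summing gives the length.
  have h1 : ∀ r, invCode k (x * simple k i) r + (if r = i then 1 else 0) =
      invCode k x (Equiv.swap i (i + 1) r) := by
    intro r
    by_cases h1 : r = i
    · subst h1
      simpa using invCode_mul_simple_left hx h
    by_cases h2 : r = i + 1
    · subst h2
      simpa [h1] using invCode_mul_simple_right hx h
    · rw [if_neg h1, Equiv.swap_apply_of_ne_of_ne h1 h2, invCode_mul_simple_of_ne hx h1 h2,
        add_zero]
  have h2 := Finset.sum_congr rfl fun r (_ : r ∈ Finset.univ) => h1 r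
  rw [Finset.sum_add_distrib, Equiv.sum_comp (Equiv.swap i (i + 1)) (invCode k x)] at h2
  simpa [len] using h2

theorem isDescent_mul_simple {x : Equiv.Perm ℤ} (hx : IsPeriodic k x) {i : ZMod (k + 1)}
    (h : ¬ IsDescent k x i) : IsDescent k (x * simple k i) i := by
  obtain ⟨n, rfl⟩ := ZMod.intCast_surjective i
  rw [isDescent_intCast (hx.mul (isPeriodic_simple _)), Equiv.Perm.mul_apply,
    Equiv.Perm.mul_apply, simple_apply_left rfl, simple_apply_right rfl]
  rw [isDescent_intCast hx, not_lt] at h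
  exact lt_of_le_of_ne h fun h' => by simpa using x.injective h'

theorem mul_simple_mul_simple (x : Equiv.Perm ℤ) (i : ZMod (k + 1)) :
    x * simple k i * simple k i = x := by
  rw [mul_assoc, simple_mul_self, mul_one]

theorem len_mul_simple_of_not_isDescent {x : Equiv.Perm ℤ} (hx : IsPeriodic k x)
    {i : ZMod (k + 1)} (h : ¬ IsDescent k x i) : len k (x * simple k i) = len k x + 1 := by
  have := len_mul_simple_of_isDescent (hx.mul (isPeriodic_simple i)) (isDescent_mul_simple hx h)
  rw [mul_simple_mul_simple] at this
  exact this.symm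

theorem wordProd_append (u v : List (ZMod (k + 1))) :
    wordProd k (u ++ v) = wordProd k u * wordProd k v := by
  simp [wordProd]

theorem wordProd_singleton (i : ZMod (k + 1)) : wordProd k [i] = simple k i := by
  simp [wordProd]

theorem isPeriodic_wordProd (w : List (ZMod (k + 1))) : IsPeriodic k (wordProd k w) := by
  induction w with
  | nil => exact isPeriodic_one
  | cons i w ih =>
    rw [← List.singleton_append, wordProd_append, wordProd_singleton]
    exact (isPeriodic_simple i).mul ih

theorem len_mul_wordProd_le {y : Equiv.Perm ℤ} (hy : IsPeriodic k y) (w : List (ZMod (k + 1))) :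
    len k (y * wordProd k w) ≤ len k y + w.length := by
  induction w using List.reverseRecOn with
  | nil => simp [wordProd]
  | append_singleton w i ih =>
    rw [wordProd_append, wordProd_singleton, ← mul_assoc, List.length_append,
      List.length_singleton]
    have hp := hy.mul (isPeriodic_wordProd w)
    by_cases h : IsDescent k (y * wordProd k w) i
    · have := len_mul_simple_of_isDescent hp h
      omega
    · have := len_mul_simple_of_not_isDescent hp h
      omega

theorem len_wordProd_le (w : List (ZMod (k + 1))) : len k (wordProd k w) ≤ w.length := by
  simpa [len_one] using len_mul_wordProd_le (isPeriodic_one (k := k)) w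

/-! ### Affine permutations through their displacements -/

theorem sum_disp_mul_simple {x : Equiv.Perm ℤ} (hx : IsPeriodic k x) (i : ZMod (k + 1)) :
    ∑ r, disp k (x * simple k i) r = ∑ r, disp k x r := by
  have h1 : ∀ r, disp k (x * simple k i) r + (if r = i + 1 then 1 else 0) =
      disp k x (Equiv.swap i (i + 1) r) + (if r = i then 1 else 0) := by
    intro r
    have hp := hx.mul (isPeriodic_simple i)
    by_cases h1 : r = i
    · subst h1
      obtain ⟨n, rfl⟩ := ZMod.intCast_surjective r
      have : (n : ZMod (k + 1)) + 1 = ((n + 1 : ℤ) : ZMod (k + 1)) := by simp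
      rw [if_neg (ne_add_one_zmod _), if_pos rfl, Equiv.swap_apply_left, this, disp_intCast hx,
        disp_intCast hp, Equiv.Perm.mul_apply, simple_apply_left rfl]
      ring
    by_cases h2 : r = i + 1
    · subst h2
      obtain ⟨n, rfl⟩ := ZMod.intCast_surjective i
      have : (n : ZMod (k + 1)) + 1 = ((n + 1 : ℤ) : ZMod (k + 1)) := by simp
      rw [if_neg h1, if_pos rfl, Equiv.swap_apply_right, this, disp_intCast hx,
        disp_intCast hp, Equiv.Perm.mul_apply, simple_apply_right rfl]
      ring
    · obtain ⟨n, rfl⟩ := ZMod.intCast_surjective r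
      rw [if_neg h1, if_neg h2, Equiv.swap_apply_of_ne_of_ne h1 h2, disp_intCast hx,
        disp_intCast hp, Equiv.Perm.mul_apply, simple_apply_of_ne h1 h2]
  have h2 := Finset.sum_congr rfl fun r (_ : r ∈ Finset.univ) => h1 r
  rw [Finset.sum_add_distrib, Finset.sum_add_distrib,
    Equiv.sum_comp (Equiv.swap i (i + 1)) (disp k x)] at h2
  simpa using h2

theorem IsAffinePerm.mul_simple {x : Equiv.Perm ℤ} (hx : IsAffinePerm k x) (i : ZMod (k + 1)) :
    IsAffinePerm k (x * simple k i) := by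
  rw [isAffinePerm_iff] at hx ⊢
  exact ⟨hx.1.mul (isPeriodic_simple i), (sum_disp_mul_simple hx.1 i).trans hx.2⟩

/-- Without inversions `x` is an increasing bijection of `ℤ`, hence a translation, and zero total
displacement makes it trivial. -/
theorem eq_one_of_len_eq_zero {k : ℕ} {x : Equiv.Perm ℤ} (hx : IsAffinePerm k x) (h : len k x = 0) :
    x = 1 := by
  obtain ⟨hp, hs⟩ := isAffinePerm_iff.1 hx
  have h0 : ∀ r, invCode k x r = 0 := by simpa [len] using h
  have hmono : StrictMono x := fun p q hpq =>
    (invCount_eq_zero hp).1 (by rw [← invCode_intCast hp, h0]) p hpq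
  have hstep : ∀ n, x (n + 1) = x n + 1 := by
    intro n
    obtain ⟨m, hm⟩ := x.surjective (x n + 1)
    have h1 : n < m := hmono.lt_iff_lt.1 (by omega)
    have h2 : x (n + 1) ≤ x m := hmono.monotone h1
    have h3 : x n < x (n + 1) := hmono (by omega)
    omega
  have hx0 : ∀ n, x n = n + x 0 := by
    intro n
    induction n using Int.induction_on with
    | zero => simp
    | succ n ih => rw [hstep, ih]; ring
    | pred n ih =>
      have := hstep (-(n : ℤ) - 1)
      rw [sub_add_cancel, ih] at this
      linarith
  have h1 : ∀ r, disp k x r = x 0 := fun r => by rw [disp, hx0]; ring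
  simp only [h1, Finset.sum_const, Finset.card_univ, ZMod.card, nsmul_eq_mul] at hs
  have h2 : x 0 = 0 := by
    rcases mul_eq_zero.1 hs with h | h
    · exact absurd h (by positivity)
    · exact h
  ext n
  rw [hx0, h2, add_zero, Equiv.Perm.one_apply]

end

section
variable {k : ℕ} [NeZero k]

/-! ### Removing a cyclically decreasing word -/

/-- The last letter must begin a run of `A`, since `i` stands to the left of `i - 1` when both
occur. This drives the inductions that peel letters off the right end. -/
theorem IsDecWord.concat {k : ℕ} {A : Finset (ZMod (k + 1))} {w : List (ZMod (k + 1))} {i : ZMod (k + 1)}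
    (h : IsDecWord k A (w ++ [i])) : i ∈ A ∧ i - 1 ∉ A ∧ IsDecWord k (A.erase i) w := by
  obtain ⟨hn, hA, hd⟩ := h
  have hw := List.nodup_append.1 hn
  have hi : i ∉ w := fun hi => hw.2.2 i hi i (by simp) rfl
  have hAw : A.erase i = w.toFinset := by
    ext j
    rw [← hA, Finset.mem_erase]
    by_cases hj : j = i
    · simp [hj, hi]
    · simp [hj]
  have hiA : i ∈ A := by simp [← hA]
  refine ⟨hiA, fun h' => ?_, hw.1, hAw.symm, fun j hj hj' => ?_⟩
  · have h1 := hd i hiA h'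
    have h2 : (w ++ [i]).idxOf (i - 1) < (w ++ [i]).length :=
      List.idxOf_lt_length_iff.2 (by simpa [← List.mem_toFinset, hA] using h')
    rw [List.idxOf_append_of_notMem hi] at h1
    simp at h1 h2
    omega
  · have h1 := hd j (Finset.mem_of_mem_erase hj) (Finset.mem_of_mem_erase hj')
    rw [hAw, List.mem_toFinset] at hj hj'
    rwa [List.idxOf_append_of_mem hj, List.idxOf_append_of_mem hj'] at h1

theorem IsDecWord.length_eq {k : ℕ} {A : Finset (ZMod (k + 1))} {w : List (ZMod (k + 1))}
    (h : IsDecWord k A w) : w.length = A.card := by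
  rw [← h.2.1, List.toFinset_card_of_nodup h.1]

/-- The effect on the inversion code of removing a cyclically decreasing word. -/
theorem invCode_of_mul_decWord {x y : Equiv.Perm ℤ} (hy : IsPeriodic k y)
    {A : Finset (ZMod (k + 1))} {w : List (ZMod (k + 1))} (hw : IsDecWord k A w)
    (hxy : x = y * wordProd k w) (hlen : len k x = len k y + w.length) :
    (∀ r ∈ A, invCode k x (r + 1) = invCode k y r + 1) ∧
      ∀ r ∉ A, r - 1 ∉ A → invCode k y r = invCode k x r := by
  induction w using List.reverseRecOn generalizing A x with
  | nil =>
    have hA : A = ∅ := hw.2.1.symm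
    subst hA
    simp [hxy, wordProd]
  | append_singleton w i ih =>
    obtain ⟨hi, hi', hw'⟩ := hw.concat
    have hp := hy.mul (isPeriodic_wordProd w)
    set z := y * wordProd k w with hz
    have hxz : x = z * simple k i := by
      rw [hxy, wordProd_append, wordProd_singleton, ← mul_assoc]
    have hzx : z = x * simple k i := by rw [hxz, mul_simple_mul_simple]
    have hx : IsPeriodic k x := hxz ▸ hp.mul (isPeriodic_simple i)
    have hle := len_mul_wordProd_le hy w
    rw [← hz] at hle
    rw [List.length_append, List.length_singleton] at hlen
    have hdes : IsDescent k x i := by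
      by_contra h
      have := len_mul_simple_of_not_isDescent hx h
      rw [← hzx] at this
      omega
    have h1 := len_mul_simple_of_isDescent hx hdes
    have hL := invCode_mul_simple_left hx hdes
    rw [← hzx] at h1 hL
    obtain ⟨ih1, ih2⟩ := ih hw' rfl (by omega)
    have hne : ∀ {r}, r ≠ i → r ≠ i + 1 → invCode k z r = invCode k x r := fun h h' => by
      rw [hzx, invCode_mul_simple_of_ne hx h h']
    constructor
    · intro r hr
      by_cases hri : r = i
      · subst hri
        rw [ih2 r (by simp) (fun h => hi' (Finset.mem_of_mem_erase h)), hL]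
      · rw [← ih1 r (Finset.mem_erase.2 ⟨hri, hr⟩), hne _ (by simpa using hri)]
        rintro rfl
        simp [hr] at hi'
    · intro r hr hr'
      have hri : r ≠ i := by rintro rfl; exact hr hi
      have hri' : r ≠ i + 1 := by rintro rfl; simp [hi] at hr'
      rw [ih2 r (fun h => hr (Finset.mem_of_mem_erase h))
        (fun h => hr' (Finset.mem_of_mem_erase h)), hne hri hri']

/-- A cyclically decreasing word can be removed if its runs start at records of `x`. -/
theorem len_mul_decWord {x y : Equiv.Perm ℤ} (hy : IsPeriodic k y)
    {A : Finset (ZMod (k + 1))} {w : List (ZMod (k + 1))} (hw : IsDecWord k A w)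
    (hxy : x = y * wordProd k w) (hpos : ∀ r ∈ A, invCode k x (r + 1) ≠ 0)
    (hzero : ∀ r ∈ A, r - 1 ∉ A → invCode k x r = 0) :
    len k x = len k y + w.length := by
  induction w using List.reverseRecOn generalizing A x with
  | nil => simp [hxy, wordProd]
  | append_singleton w i ih =>
    obtain ⟨hi, hi', hw'⟩ := hw.concat
    have hp := hy.mul (isPeriodic_wordProd w)
    set z := y * wordProd k w with hz
    have hxz : x = z * simple k i := by
      rw [hxy, wordProd_append, wordProd_singleton, ← mul_assoc]
    have hzx : z = x * simple k i := by rw [hxz, mul_simple_mul_simple]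
    have hx : IsPeriodic k x := hxz ▸ hp.mul (isPeriodic_simple i)
    -- Position `i` is a record. Were `i` not a descent, `i + 1` would be a record too, against
    -- positivity of its count.
    have hdes : IsDescent k x i := by
      have h1 := hpos i hi
      have h2 := hzero i hi hi'
      obtain ⟨n, rfl⟩ := ZMod.intCast_surjective i
      rw [isDescent_intCast hx]
      by_contra h
      rw [invCode_intCast hx, invCount_eq_zero hx] at h2
      refine h1 ?_
      have : (n : ZMod (k + 1)) + 1 = ((n + 1 : ℤ) : ZMod (k + 1)) := by simp
      rw [this, invCode_intCast hx, invCount_eq_zero hx]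
      intro p hp
      have hlt : x n < x (n + 1) :=
        lt_of_le_of_ne (not_lt.1 h) fun h' => by simpa using x.injective h'
      rcases (Int.lt_add_one_iff.1 hp).lt_or_eq with h3 | rfl
      exacts [(h2 p h3).trans hlt, hlt]
    have h1 := len_mul_simple_of_isDescent hx hdes
    have hR := invCode_mul_simple_right hx hdes
    rw [← hzx] at h1 hR
    have hne : ∀ {r}, r ≠ i → r ≠ i + 1 → invCode k z r = invCode k x r := fun h h' => by
      rw [hzx, invCode_mul_simple_of_ne hx h h']
    have := ih hw' rfl (fun r hr => ?_) (fun r hr hr' => ?_)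
    · rw [List.length_append, List.length_singleton]
      omega
    · obtain ⟨hri, hrA⟩ := Finset.mem_erase.1 hr
      rw [hne _ (by simpa using hri)]
      · exact hpos r hrA
      · rintro rfl
        simp [hrA] at hi'
    · obtain ⟨hri, hrA⟩ := Finset.mem_erase.1 hr
      -- The record moves from `i` to `i + 1` when `s_i` is removed, so the rest of the run again
      -- starts at a record.
      by_cases hri' : r = i + 1
      · rw [hri', hR]
        exact hzero i hi hi'
      · rw [hne hri hri']
        refine hzero r hrA fun h => hr' (Finset.mem_erase.2 ⟨?_, h⟩)
        rintro rfl
        simp at hri'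

theorem IsDecWord.append_singleton {k : ℕ} {A : Finset (ZMod (k + 1))} {w : List (ZMod (k + 1))}
    {i : ZMod (k + 1)} (h : IsDecWord k (A.erase i) w) (hi : i ∈ A) (hi' : i - 1 ∉ A) :
    IsDecWord k A (w ++ [i]) := by
  obtain ⟨hn, hA, hd⟩ := h
  have hmem : ∀ j, j ∈ w ↔ j ≠ i ∧ j ∈ A := fun j => by
    rw [← List.mem_toFinset, hA, Finset.mem_erase]
  have hiw : i ∉ w := fun h => ((hmem i).1 h).1 rfl
  refine ⟨List.nodup_append.2 ⟨hn, List.nodup_singleton i, ?_⟩, ?_, fun j hj hj' => ?_⟩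
  · rintro a ha b hb rfl
    rw [List.mem_singleton] at hb
    exact hiw (hb ▸ ha)
  · rw [List.toFinset_append, hA]
    ext j
    by_cases hj : j = i <;> simp [hj, hi]
  · have hji : j ≠ i := by rintro rfl; exact hi' hj'
    have hjw : j ∈ w := (hmem j).2 ⟨hji, hj⟩
    rw [List.idxOf_append_of_mem hjw]
    by_cases hji' : j - 1 = i
    · rw [hji', List.idxOf_append_of_notMem hiw]
      have := List.idxOf_lt_length_iff.2 hjw
      omega
    · rw [List.idxOf_append_of_mem ((hmem _).2 ⟨hji', hj'⟩)]
      exact hd j (Finset.mem_erase.2 ⟨hji, hj⟩) (Finset.mem_erase.2 ⟨hji', hj'⟩)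

/-- A nonempty proper subset of the cycle has a run with a beginning; this is where properness is
needed to order `A` into a word. -/
theorem eq_univ_of_sub_one_mem {k : ℕ} {A : Finset (ZMod (k + 1))} (hA : A.Nonempty)
    (h : ∀ i ∈ A, i - 1 ∈ A) : A = Finset.univ := by
  obtain ⟨a, ha⟩ := hA
  have h1 : ∀ n : ℕ, a - n ∈ A := by
    intro n
    induction n with
    | zero => simpa using ha
    | succ n ih =>
      have := h _ ih
      rwa [sub_sub, ← Nat.cast_add_one] at this
  refine Finset.eq_univ_iff_forall.2 fun r => ?_
  have := h1 (a - r).val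
  rwa [ZMod.natCast_zmod_val, sub_sub_cancel] at this

theorem exists_isDecWord {k : ℕ} {A : Finset (ZMod (k + 1))} (hA : A ≠ Finset.univ) :
    ∃ w, IsDecWord k A w := by
  induction A using Finset.strongInduction with
  | _ A ih =>
  rcases A.eq_empty_or_nonempty with rfl | hne
  · exact ⟨[], List.nodup_nil, rfl, by simp⟩
  · obtain ⟨i, hi, hi'⟩ : ∃ i ∈ A, i - 1 ∉ A := by
      by_contra! h
      exact hA (eq_univ_of_sub_one_mem hne h)
    obtain ⟨w, hw⟩ := ih _ (Finset.erase_ssubset hi) fun h =>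
      Finset.notMem_erase i A (h ▸ Finset.mem_univ i)
    exact ⟨w ++ [i], hw.append_singleton hi hi'⟩

/-! ### The greedy decomposition -/

/-- The residues that can be removed from `x` in one step. -/
noncomputable def firstRow (k : ℕ) (α : ZMod (k + 1) → ℕ) : Finset (ZMod (k + 1)) :=
  Finset.univ.filter fun i => 0 < α i

/-- The code of which the first row has been removed. -/
def tailCode (k : ℕ) (α : ZMod (k + 1) → ℕ) (i : ZMod (k + 1)) : ℕ :=
  α (i + 1) - 1

theorem decRows_eq_nil {k : ℕ} {α : ZMod (k + 1) → ℕ} (h : ∀ i, α i = 0) : decRows k α = [] := by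
  have : Finset.univ.sup α = 0 := by
    refine Nat.le_zero.1 (Finset.sup_le fun i _ => (h i).le)
  simp [decRows, this]

theorem decRows_eq_cons {k : ℕ} {α : ZMod (k + 1) → ℕ} {i : ZMod (k + 1)} (h : α i ≠ 0) :
    decRows k α = firstRow k α :: decRows k (tailCode k α) := by
  have hsup : Finset.univ.sup α = Finset.univ.sup (tailCode k α) + 1 := by
    refine le_antisymm (Finset.sup_le fun j _ => ?_) ?_
    · have h1 : tailCode k α (j - 1) ≤ Finset.univ.sup (tailCode k α) :=
        Finset.le_sup (Finset.mem_univ _)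
      have h2 : tailCode k α (j - 1) = α j - 1 := by rw [tailCode, sub_add_cancel]
      omega
    · obtain ⟨j, -, hj⟩ := Finset.exists_mem_eq_sup Finset.univ Finset.univ_nonempty (tailCode k α)
      have h1 : α (j + 1) ≤ Finset.univ.sup α := Finset.le_sup (Finset.mem_univ _)
      have h2 : α i ≤ Finset.univ.sup α := Finset.le_sup (Finset.mem_univ _)
      rw [hj, tailCode]
      omega
  rw [decRows, hsup, List.range_succ_eq_map, List.map_cons, List.map_map]
  congr 1
  · simp [firstRow]
  · refine List.map_congr_left fun j _ => ?_
    ext r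
    simp only [Function.comp, Finset.mem_image, Finset.mem_filter_univ]
    constructor
    · rintro ⟨i, hi, rfl⟩
      refine ⟨i - 1, by rw [tailCode, sub_add_cancel]; omega, ?_⟩
      push_cast
      ring
    · rintro ⟨i, hi, rfl⟩
      rw [tailCode] at hi
      refine ⟨i + 1, by omega, ?_⟩
      push_cast
      ring

/-- The code of a periodic permutation: its value at `i` counts the inversions of position
`i + 1` with positions to the left. -/
noncomputable def decCode (k : ℕ) (x : Equiv.Perm ℤ) (i : ZMod (k + 1)) : ℕ :=
  invCode k x (i + 1)

theorem sum_decCode {k : ℕ} (x : Equiv.Perm ℤ) : ∑ i, decCode k x i = len k x :=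
  Equiv.sum_comp (Equiv.addRight (1 : ZMod (k + 1))) (invCode k x)

theorem mem_firstRow {k : ℕ} {α : ZMod (k + 1) → ℕ} {i : ZMod (k + 1)} : i ∈ firstRow k α ↔ α i ≠ 0 := by
  simp [firstRow, Nat.pos_iff_ne_zero]

theorem subset_firstRow {x y : Equiv.Perm ℤ} (hy : IsPeriodic k y)
    {A : Finset (ZMod (k + 1))} {w : List (ZMod (k + 1))} (hw : IsDecWord k A w)
    (hxy : x = y * wordProd k w) (hlen : len k x = len k y + w.length) :
    A ⊆ firstRow k (decCode k x) := fun r hr => by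
  rw [mem_firstRow, decCode, (invCode_of_mul_decWord hy hw hxy hlen).1 r hr]
  simp

/-- Removal lowers each of the `|A|` positive entries by one and shifts it to `A`. These shifted
entries already sum to `len k y`, so every entry of `y` outside `A` vanishes. -/
theorem decCode_eq_tailCode {x y : Equiv.Perm ℤ} (hy : IsPeriodic k y)
    {w : List (ZMod (k + 1))} (hw : IsDecWord k (firstRow k (decCode k x)) w)
    (hxy : x = y * wordProd k w) (hlen : len k x = len k y + w.length) :
    decCode k y = tailCode k (decCode k x) := by
  set A := firstRow k (decCode k x) with hA
  have h1 := (invCode_of_mul_decWord hy hw hxy hlen).1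
  have h2 : ∀ r ∉ A, invCode k y r = 0 := by
    have e1 : ∑ r ∈ A, invCode k y r + A.card = len k x := by
      rw [← sum_decCode, ← Finset.sum_subset (Finset.subset_univ A)
        (fun r _ hr => by simpa [hA, mem_firstRow] using hr), Finset.card_eq_sum_ones,
        ← Finset.sum_add_distrib]
      exact Finset.sum_congr rfl fun r hr => (h1 r hr).symm
    have e2 : ∑ r ∈ A, invCode k y r + ∑ r ∈ Aᶜ, invCode k y r = len k y :=
      Finset.sum_add_sum_compl A _
    rw [hw.length_eq] at hlen
    have e3 : ∑ r ∈ Aᶜ, invCode k y r = 0 := by omega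
    intro r hr
    exact Finset.sum_eq_zero_iff.1 e3 r (Finset.mem_compl.2 hr)
  funext i
  rw [tailCode, decCode]
  by_cases hi : i + 1 ∈ A
  · rw [decCode, h1 _ hi]
    simp
  · rw [h2 _ hi]
    rw [hA, mem_firstRow, not_not] at hi
    rw [hi]

theorem IsAffinePerm.isPeriodic {k : ℕ} {x : Equiv.Perm ℤ} (hx : IsAffinePerm k x) : IsPeriodic k x := hx.1

theorem IsAffinePerm.mul_inv_wordProd {x : Equiv.Perm ℤ} (hx : IsAffinePerm k x)
    (w : List (ZMod (k + 1))) : IsAffinePerm k (x * (wordProd k w)⁻¹) := by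
  induction w using List.reverseRecOn generalizing x with
  | nil => simpa [wordProd] using hx
  | append_singleton w i ih =>
    rw [wordProd_append, wordProd_singleton, mul_inv_rev, ← mul_assoc,
      inv_eq_of_mul_eq_one_left (simple_mul_self i)]
    exact ih (hx.mul_simple i)

theorem firstRow_ne_univ {k : ℕ} {x : Equiv.Perm ℤ} (hx : IsPeriodic k x) :
    firstRow k (decCode k x) ≠ Finset.univ := by
  obtain ⟨r, hr⟩ := exists_invCode_eq_zero hx
  intro h
  have : r - 1 ∈ firstRow k (decCode k x) := h ▸ Finset.mem_univ _
  rw [mem_firstRow, decCode, sub_add_cancel] at this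
  exact this hr

theorem len_mul_firstRow {x y : Equiv.Perm ℤ} (hy : IsPeriodic k y)
    {w : List (ZMod (k + 1))} (hw : IsDecWord k (firstRow k (decCode k x)) w)
    (hxy : x = y * wordProd k w) : len k x = len k y + w.length := by
  refine len_mul_decWord hy hw hxy (fun r hr => (mem_firstRow (α := decCode k x)).1 hr) fun r _ hr => ?_
  rw [mem_firstRow, not_not, decCode, sub_add_cancel] at hr
  exact hr

/-- The rows of the code form a cyclically decreasing decomposition of length `len k x`. -/
theorem exists_decRows_words {x : Equiv.Perm ℤ} (hx : IsAffinePerm k x) :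
    (∀ S ∈ decRows k (decCode k x), S.Nonempty ∧ S ≠ Finset.univ) ∧
      ∃ ws, List.Forall₂ (IsDecWord k) (decRows k (decCode k x)) ws ∧
        wordProd k ws.reverse.flatten = x ∧ ws.reverse.flatten.length = len k x := by
  induction h : len k x using Nat.strong_induction_on generalizing x with
  | _ l ih =>
  by_cases h0 : ∀ i, decCode k x i = 0
  · have hl : len k x = 0 := by rw [← sum_decCode]; exact Finset.sum_eq_zero fun i _ => h0 i
    rw [decRows_eq_nil h0]
    refine ⟨by simp, [], .nil, ?_, by simp [← h, hl]⟩
    rw [eq_one_of_len_eq_zero hx hl]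
    rfl
  · push Not at h0
    obtain ⟨i, hi⟩ := h0
    obtain ⟨w, hw⟩ := exists_isDecWord (firstRow_ne_univ hx.isPeriodic)
    have hy := hx.mul_inv_wordProd w
    have hxy : x = x * (wordProd k w)⁻¹ * wordProd k w := by group
    have hlen := len_mul_firstRow hy.isPeriodic hw hxy
    have hpos : 0 < w.length := by
      rw [hw.length_eq]
      exact Finset.card_pos.2 ⟨i, mem_firstRow.2 hi⟩
    obtain ⟨h1, ws, h2, h3, h4⟩ := ih _ (by omega) hy rfl
    rw [decRows_eq_cons hi, ← decCode_eq_tailCode hy.isPeriodic hw hxy hlen]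
    refine ⟨?_, w :: ws, h2.cons hw, ?_, ?_⟩
    · rintro S (_ | ⟨_, hS⟩)
      · exact ⟨⟨i, mem_firstRow.2 hi⟩, firstRow_ne_univ hx.isPeriodic⟩
      · exact h1 S hS
    · rw [List.reverse_cons, List.flatten_append, wordProd_append, h3]
      simp [List.flatten]
    · rw [List.reverse_cons, List.flatten_append, List.length_append, h4]
      simp only [List.flatten_cons, List.flatten_nil, List.append_nil]
      omega

/-- `len` bounds the length of every word from below, and the words read off the rows of the code
attain it. -/
theorem isReducedWord_iff {x : Equiv.Perm ℤ} (hx : IsAffinePerm k x) (w : List (ZMod (k + 1))) :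
    IsReducedWord k x w ↔ wordProd k w = x ∧ w.length = len k x := by
  refine and_congr_right fun hw => ⟨fun h => ?_, fun h w' hw' => ?_⟩
  · obtain ⟨-, ws, -, h1, h2⟩ := exists_decRows_words hx
    have h3 := h _ h1
    have h4 := len_wordProd_le w
    rw [hw] at h4
    omega
  · rw [h, ← hw']
    exact len_wordProd_le w'

theorem isDecExpr_decRows {x : Equiv.Perm ℤ} (hx : IsAffinePerm k x) :
    IsDecExpr k x (decRows k (decCode k x)) := by
  obtain ⟨h1, ws, h2, h3⟩ := exists_decRows_words hx
  exact ⟨h1, ws, h2, (isReducedWord_iff hx _).2 h3⟩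

/-- The first set is contained in the support of the code. Strict containment already loses in the
first lexicographic entry; equality leaves the same comparison for the shorter permutation. -/
theorem eq_decRows_or_shape_lt {x : Equiv.Perm ℤ} (hx : IsAffinePerm k x)
    {A : List (Finset (ZMod (k + 1)))} (hA : IsDecExpr k x A) :
    A = decRows k (decCode k x) ∨ shape A < shape (decRows k (decCode k x)) := by
  obtain ⟨hS, ws, hws, hred⟩ := hA
  rw [isReducedWord_iff hx] at hred
  induction hws generalizing x with
  | nil =>
    left
    rw [decRows_eq_nil]
    have := hred.2
    rw [List.reverse_nil, List.flatten_nil, List.length_nil, ← sum_decCode, eq_comm] at this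
    exact fun i => Finset.sum_eq_zero_iff.1 this i (Finset.mem_univ i)
  | @cons S w A ws hw hws ih =>
    simp only [List.reverse_cons, List.flatten_append, List.flatten_cons, List.flatten_nil,
      List.append_nil, wordProd_append, List.length_append] at hred
    obtain ⟨h1, h2⟩ := hred
    set u := ws.reverse.flatten with hu
    have hy : IsAffinePerm k (wordProd k u) := by
      rw [← mul_inv_eq_iff_eq_mul.2 h1.symm]
      exact hx.mul_inv_wordProd w
    have h3 := len_mul_wordProd_le hy.isPeriodic w
    have h4 := len_wordProd_le u
    rw [h1] at h3
    have hlen : len k x = len k (wordProd k u) + w.length := by omega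
    have hsub := subset_firstRow hy.isPeriodic hw h1.symm hlen
    obtain ⟨i, hi⟩ := (hS S (by simp)).1
    rw [decRows_eq_cons (mem_firstRow.1 (hsub hi))]
    by_cases hSD : S = firstRow k (decCode k x)
    · subst hSD
      rw [← decCode_eq_tailCode hy.isPeriodic hw h1.symm hlen]
      rcases ih hy (fun S hS' => hS S (List.mem_cons_of_mem _ hS')) ⟨rfl, by omega⟩ with h | h
      · exact Or.inl (congrArg _ h)
      · exact Or.inr (List.cons_lt_cons_iff.2 (Or.inr ⟨rfl, h⟩))
    · exact Or.inr (List.cons_lt_cons_iff.2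
        (Or.inl (Finset.card_lt_card (hsub.ssubset_of_ne hSD))))

/-- Every affine permutation has exactly one maximal decreasing expression, given by its
inversion code. -/
theorem isRD_decCode {x : Equiv.Perm ℤ} (hx : IsAffinePerm k x) : IsRD k x (decCode k x) := by
  constructor
  · obtain ⟨r, hr⟩ := exists_invCode_eq_zero hx.isPeriodic
    exact ⟨r - 1, by rw [decCode, sub_add_cancel, hr]⟩
  · refine fun A => ⟨fun hA => ?_, ?_⟩
    · refine (eq_decRows_or_shape_lt hx hA.1).resolve_right fun h => ?_
      exact absurd (hA.2 _ (isDecExpr_decRows hx)) (not_le.2 h)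
    · rintro rfl
      refine ⟨isDecExpr_decRows hx, fun B hB => ?_⟩
      rcases eq_decRows_or_shape_lt hx hB with rfl | h
      exacts [le_rfl, h.le]

end

/-! ### Beads and gaps of a diagram -/

/-- The bead of row `j`. -/
def bead (c : YoungDiagram) (j : ℕ) : ℤ := c.rowLen j - j

/-- The gap of column `m`. -/
def gap (c : YoungDiagram) (m : ℕ) : ℤ := m + 1 - c.colLen m

theorem bead_strictAnti (c : YoungDiagram) : StrictAnti (bead c) := fun i j h => by
  have := c.rowLen_anti i j h.le
  unfold bead
  omega

theorem gap_strictMono (c : YoungDiagram) : StrictMono (gap c) := fun i j h => by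
  have := c.colLen_anti i j h.le
  unfold gap
  omega

theorem gap_lt_bead_iff {c : YoungDiagram} {j m : ℕ} : gap c m < bead c j ↔ (j, m) ∈ c := by
  have h1 := c.mem_iff_lt_rowLen (i := j) (j := m)
  have h2 := c.mem_iff_lt_colLen (i := j) (j := m)
  unfold gap bead
  by_cases h : (j, m) ∈ c
  · have := h1.1 h
    have := h2.1 h
    simp only [h, iff_true]
    omega
  · have := mt h1.2 h
    have := mt h2.2 h
    simp only [h, iff_false]
    omega

theorem gap_ne_bead {c : YoungDiagram} {j m : ℕ} : gap c m ≠ bead c j := by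
  have h1 := c.mem_iff_lt_rowLen (i := j) (j := m)
  have h2 := c.mem_iff_lt_colLen (i := j) (j := m)
  rw [h1] at h2
  unfold gap bead
  omega

theorem hook_eq {c : YoungDiagram} {j m : ℕ} (h : (j, m) ∈ c) :
    (hook c (j, m) : ℤ) = bead c j - gap c m := by
  have h1 := c.mem_iff_lt_rowLen.1 h
  have h2 := c.mem_iff_lt_colLen.1 h
  simp only [hook]
  unfold gap bead
  omega

theorem exists_rowLen_eq_zero (c : YoungDiagram) : ∃ J, ∀ j, J ≤ j → c.rowLen j = 0 := by
  refine ⟨c.colLen 0, fun j hj => ?_⟩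
  by_contra h
  have h1 := c.mem_iff_lt_rowLen.2 (Nat.pos_of_ne_zero h)
  have h2 := c.mem_iff_lt_colLen.1 h1
  omega

/-- Let `j` be the first row whose bead is at most `z`. If that bead is not `z`, then `z` is the gap
of the column with index `z + j - 1`. -/
theorem exists_bead_or_gap (c : YoungDiagram) (z : ℤ) :
    (∃ j, bead c j = z) ∨ ∃ m, gap c m = z := by
  have hex : ∃ j, bead c j ≤ z := by
    obtain ⟨J, hJ⟩ := exists_rowLen_eq_zero c
    refine ⟨max J (-z).toNat, ?_⟩
    rw [bead, hJ _ (le_max_left _ _)]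
    omega
  classical
  have h1 := Nat.find_spec hex
  have h2 := fun i => Nat.find_min hex (m := i)
  set j := Nat.find hex
  rcases h1.eq_or_lt with h | h
  · exact Or.inl ⟨j, h⟩
  · right
    rw [bead] at h
    refine ⟨(z + j - 1).toNat, ?_⟩
    have hm : ((z + j - 1).toNat : ℤ) = z + j - 1 := by omega
    -- Row `j` is too short to meet this column, while row `j - 1`, whose bead exceeds `z`, meets
    -- it.
    have hcol : c.colLen (z + j - 1).toNat = j := by
      have h3 : ¬ j < c.colLen (z + j - 1).toNat := by
        rw [← c.mem_iff_lt_colLen, c.mem_iff_lt_rowLen]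
        omega
      refine le_antisymm (not_lt.1 h3) ?_
      rcases Nat.eq_zero_or_pos j with h0 | h0
      · omega
      · have h4 := h2 (j - 1) (by omega)
        rw [bead] at h4
        have h5 : (j - 1, (z + j - 1).toNat) ∈ c := by
          rw [c.mem_iff_lt_rowLen]
          omega
        rw [c.mem_iff_lt_colLen] at h5
        omega
    rw [gap, hcol]
    omega

theorem eq_of_rowLen {c d : YoungDiagram} (h : ∀ i, c.rowLen i = d.rowLen i) : c = d := by
  ext ⟨i, j⟩
  rw [YoungDiagram.mem_cells, YoungDiagram.mem_cells, c.mem_iff_lt_rowLen, d.mem_iff_lt_rowLen, h]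

theorem exists_youngDiagram {f : ℕ → ℕ} (hf : Antitone f) {J : ℕ} (hJ : f J = 0) :
    ∃ c : YoungDiagram, ∀ i, c.rowLen i = f i := by
  have hmem : ∀ b : ℕ × ℕ, b ∈ (Finset.range J ×ˢ Finset.range (f 0)).filter (fun b => b.2 < f b.1) ↔
      b.2 < f b.1 := by
    rintro ⟨i, j⟩
    simp only [Finset.mem_filter, Finset.mem_product, Finset.mem_range, and_iff_right_iff_imp]
    intro h
    have h1 : f i ≤ f 0 := hf (Nat.zero_le _)
    refine ⟨?_, by omega⟩
    by_contra h2
    have h3 : f i ≤ f J := hf (not_lt.1 h2)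
    omega
  refine ⟨⟨(Finset.range J ×ˢ Finset.range (f 0)).filter fun b => b.2 < f b.1, ?_⟩, fun i => ?_⟩
  · rintro ⟨a, b⟩ ⟨a', b'⟩ ⟨h1, h2⟩ h
    rw [Finset.mem_coe, hmem] at h ⊢
    have h3 : f a ≤ f a' := hf h1
    simp only at h h2 ⊢
    omega
  · refine eq_of_forall_lt_iff fun j => ?_
    rw [← YoungDiagram.mem_iff_lt_rowLen, ← YoungDiagram.mem_cells, hmem]

/-! ### Cores and bounded partitions -/

/-- The number of boxes of row `i` whose hook length is at most `k + 1`. -/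
def shortHooks (k : ℕ) (c : YoungDiagram) (i : ℕ) : ℕ :=
  (c.cells.filter fun b => b.1 = i ∧ hook c b ≤ k + 1).card

/-- The gaps among the `k + 1` integers below the bead of row `j`. -/
theorem shortHooks_eq_card_gaps {k : ℕ} {c : YoungDiagram} {j : ℕ} (G : Finset ℤ)
    (hG : ∀ z, z ∈ G ↔ z ∈ Finset.Ico (bead c j - (k + 1)) (bead c j) ∧ ∃ m, gap c m = z) :
    shortHooks k c j = G.card := by
  refine Finset.card_bij (fun b _ => gap c b.2) ?_ ?_ ?_
  · rintro ⟨i, m⟩ hb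
    simp only [Finset.mem_filter, YoungDiagram.mem_cells] at hb
    obtain ⟨hc, rfl, hh⟩ := hb
    have h1 := hook_eq hc
    have h2 := gap_lt_bead_iff.2 hc
    rw [hG, Finset.mem_Ico]
    exact ⟨⟨by simp only; omega, h2⟩, m, rfl⟩
  · rintro ⟨i, m⟩ hb ⟨i', m'⟩ hb' h
    simp only [Finset.mem_filter] at hb hb'
    exact Prod.ext (hb.2.1.trans hb'.2.1.symm) ((gap_strictMono c).injective h)
  · intro z hz
    rw [hG, Finset.mem_Ico] at hz
    obtain ⟨⟨h1, h2⟩, m, rfl⟩ := hz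
    have hc := gap_lt_bead_iff.1 h2
    have := hook_eq hc
    exact ⟨(j, m), by simp only [Finset.mem_filter, YoungDiagram.mem_cells, hc, true_and]; omega, rfl⟩

/-- Hooks are bead-gap differences, so a hook of length `k + 1` is a gap sitting `k + 1` below a
bead. -/
theorem isCore_iff {k : ℕ} {c : YoungDiagram} :
    IsCore k c ↔ ∀ j, ∃ l, bead c l = bead c j - (k + 1) := by
  constructor
  · intro h j
    refine (exists_bead_or_gap c _).resolve_right ?_
    rintro ⟨m, hm⟩
    have hc : (j, m) ∈ c := gap_lt_bead_iff.1 (by omega)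
    have h1 := hook_eq hc
    have h2 := h (j, m) hc
    omega
  · rintro h ⟨j, m⟩ hc
    rw [YoungDiagram.mem_cells] at hc
    obtain ⟨l, hl⟩ := h j
    have h1 := hook_eq hc
    intro h2
    refine gap_ne_bead (c := c) (j := l) (m := m) ?_
    omega

/-- The `k + 1` integers below bead `j` split into gaps, counted by `shortHooks`, and the beads of
rows `j + 1, …, l`. -/
theorem shortHooks_add {k : ℕ} {c : YoungDiagram} {j l : ℕ}
    (h : bead c l = bead c j - (k + 1)) : j < l ∧ shortHooks k c j + (l - j) = k + 1 := by
  have hjl : j < l := (bead_strictAnti c).lt_iff_gt.1 (by omega)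
  refine ⟨hjl, ?_⟩
  classical
  set I := Finset.Ico (bead c j - (k + 1)) (bead c j) with hI
  have h1 := shortHooks_eq_card_gaps (k := k) (c := c) (j := j)
    (I.filter fun z => ∃ m, gap c m = z) (fun z => by rw [Finset.mem_filter])
  have h2 : ((I.filter fun z => ¬ ∃ m, gap c m = z)).card = l - j := by
    have : (I.filter fun z => ¬ ∃ m, gap c m = z) = (Finset.Ioc j l).image (bead c) := by
      ext z
      rw [Finset.mem_filter, hI, Finset.mem_Ico, Finset.mem_image]
      constructor
      · rintro ⟨⟨h1, h2⟩, h3⟩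
        obtain ⟨i, rfl⟩ := (exists_bead_or_gap c z).resolve_right h3
        rw [← h] at h1
        exact ⟨i, Finset.mem_Ioc.2
          ⟨(bead_strictAnti c).lt_iff_gt.1 h2, (bead_strictAnti c).le_iff_ge.1 h1⟩, rfl⟩
      · rintro ⟨i, hi, rfl⟩
        rw [Finset.mem_Ioc] at hi
        rw [← h]
        exact ⟨⟨(bead_strictAnti c).antitone hi.2, bead_strictAnti c hi.1⟩,
          fun ⟨m, hm⟩ => gap_ne_bead hm⟩
    rw [this, Finset.card_image_of_injective _ (bead_strictAnti c).injective, Nat.card_Ioc]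
  have h3 := I.card_filter_add_card_filter_not (fun z => ∃ m, gap c m = z)
  rw [h2, ← h1, hI, Int.card_Ico] at h3
  omega

theorem IsCore.bead_sub {k : ℕ} {c : YoungDiagram} (hc : IsCore k c) (j : ℕ) :
    shortHooks k c j ≤ k ∧ bead c (j + (k + 1 - shortHooks k c j)) = bead c j - (k + 1) := by
  obtain ⟨l, hl⟩ := isCore_iff.1 hc j
  obtain ⟨h1, h2⟩ := shortHooks_add hl
  refine ⟨by omega, ?_⟩
  rw [← hl]
  congr 1
  omega

/-- Shifting down by `k + 1` preserves the order of beads; compare the row indices at which the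
shifted beads of rows `j` and `j + 1` occur. -/
theorem IsCore.shortHooks_antitone {k : ℕ} {c : YoungDiagram} (hc : IsCore k c) :
    Antitone (shortHooks k c) := by
  refine antitone_nat_of_succ_le fun j => ?_
  obtain ⟨h1, h2⟩ := hc.bead_sub j
  obtain ⟨h3, h4⟩ := hc.bead_sub (j + 1)
  have h5 := bead_strictAnti c (Nat.lt_succ_self j)
  have h6 := (bead_strictAnti c).lt_iff_gt.1
    (h4.trans_lt ((sub_lt_sub_right h5 _).trans_eq h2.symm))
  omega

theorem shortHooks_le (k : ℕ) (c : YoungDiagram) (i : ℕ) : shortHooks k c i ≤ c.rowLen i := by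
  rw [c.rowLen_eq_card]
  refine Finset.card_le_card fun b hb => ?_
  rw [Finset.mem_filter] at hb
  exact Finset.mem_filter.2 ⟨hb.1, hb.2.1⟩

theorem isCoreOf_iff {k : ℕ} {c lam : YoungDiagram} :
    IsCoreOf k c lam ↔ IsCore k c ∧ ∀ i, lam.rowLen i = shortHooks k c i :=
  Iff.rfl

theorem IsCore.exists_isCoreOf {k : ℕ} {c : YoungDiagram} (hc : IsCore k c) :
    ∃ lam, IsBounded k lam ∧ IsCoreOf k c lam := by
  obtain ⟨J, hJ⟩ := exists_rowLen_eq_zero c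
  obtain ⟨lam, hlam⟩ := exists_youngDiagram hc.shortHooks_antitone (J := J)
    (Nat.le_zero.1 ((shortHooks_le k c J).trans (hJ J le_rfl).le))
  exact ⟨lam, fun i => hlam i ▸ (hc.bead_sub i).1, hc, hlam⟩

theorem IsCoreOf.partition_unique {k : ℕ} {c lam mu : YoungDiagram} (h1 : IsCoreOf k c lam)
    (h2 : IsCoreOf k c mu) : lam = mu :=
  eq_of_rowLen fun i => (h1.2 i).trans (h2.2 i).symm

/-- A core is determined by its bounded partition. -/
theorem IsCoreOf.core_unique {k : ℕ} {c d lam : YoungDiagram} (h1 : IsCoreOf k c lam)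
    (h2 : IsCoreOf k d lam) : c = d := by
  rw [isCoreOf_iff] at h1 h2
  obtain ⟨J, hJ⟩ := exists_rowLen_eq_zero c
  obtain ⟨J', hJ'⟩ := exists_rowLen_eq_zero d
  -- `IsCore.bead_sub` recovers bead `j` from a bead of strictly larger index, so agreement spreads
  -- upwards from the empty rows.
  have key : ∀ n j, max J J' ≤ j + n → bead c j = bead d j := by
    intro n
    induction n with
    | zero =>
      intro j hj
      rw [bead, bead, hJ j (by omega), hJ' j (by omega)]
    | succ n ih =>
      intro j hj
      obtain ⟨h3, h4⟩ := h1.1.bead_sub j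
      obtain ⟨-, h5⟩ := h2.1.bead_sub j
      have h6 : shortHooks k d j = shortHooks k c j := by rw [← h1.2, ← h2.2]
      rw [h6] at h5
      have := ih (j + (k + 1 - shortHooks k c j)) (by omega)
      omega
  refine eq_of_rowLen fun j => ?_
  have := key (max J J') j (Nat.le_add_left _ _)
  unfold bead at this
  omega

theorem bead_transpose (c : YoungDiagram) (j : ℕ) : bead c.transpose j = 1 - gap c j := by
  rw [bead, gap, c.rowLen_transpose]
  ring

theorem IsCore.transpose {k : ℕ} {c : YoungDiagram} (hc : IsCore k c) : IsCore k c.transpose := by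
  rintro ⟨i, j⟩ h
  rw [YoungDiagram.mem_cells, YoungDiagram.mem_transpose] at h
  have := hc _ h
  simp only [hook, YoungDiagram.rowLen_transpose, YoungDiagram.colLen_transpose, Prod.swap] at this ⊢
  omega

/-! ### The core of a Grassmannian permutation -/

theorem IsPeriodic.apply_add_mul {k : ℕ} {x : Equiv.Perm ℤ} (hx : IsPeriodic k x) (n t : ℤ) :
    x (n + t * (k + 1)) = x n + t * (k + 1) := by
  have h : Function.Periodic (fun n => x n - n) ((k : ℤ) + 1) := fun n => by
    have := hx n
    simp only
    omega
  have := h.int_mul t n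
  simp only [Int.cast_id] at this
  omega

theorem IsCoreOfPerm.exists_bead_iff {x : Equiv.Perm ℤ} {c : YoungDiagram}
    (hc : IsCoreOfPerm x c) (z : ℤ) : (∃ j, bead c j = z) ↔ x.symm z ≤ 0 := by
  have : z ∈ x '' Set.Iic 0 ↔ z ∈ Set.range (bead c) := by rw [hc]; rfl
  rw [Equiv.image_eq_preimage_symm] at this
  exact this.symm

theorem IsCoreOfPerm.exists_gap_iff {x : Equiv.Perm ℤ} {c : YoungDiagram}
    (hc : IsCoreOfPerm x c) (z : ℤ) : (∃ m, gap c m = z) ↔ 0 < x.symm z := by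
  rw [← not_le, ← hc.exists_bead_iff]
  constructor
  · rintro ⟨m, rfl⟩ ⟨j, hj⟩
    exact gap_ne_bead hj.symm
  · exact (exists_bead_or_gap c z).resolve_left

theorem IsCoreOfPerm.core_unique {x : Equiv.Perm ℤ} {c d : YoungDiagram}
    (hc : IsCoreOfPerm x c) (hd : IsCoreOfPerm x d) : c = d := by
  have h1 : Set.range (bead c) = Set.range (bead d) := hc.symm.trans hd
  have h : (fun j => -bead c j) = fun j => -bead d j := by
    refine (StrictMono.range_inj (fun i j hij => neg_lt_neg (bead_strictAnti c hij))
      (fun i j hij => neg_lt_neg (bead_strictAnti d hij))).1 ?_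
    change Set.range (Neg.neg ∘ bead c) = Set.range (Neg.neg ∘ bead d)
    rw [Set.range_comp, Set.range_comp, h1]
  refine eq_of_rowLen fun j => ?_
  have := congrFun h j
  simp only [bead] at this
  omega

theorem IsCoreOfPerm.isCore {k : ℕ} {x : Equiv.Perm ℤ} (hx : IsPeriodic k x) {c : YoungDiagram}
    (hc : IsCoreOfPerm x c) : IsCore k c := by
  rw [isCore_iff]
  intro j
  rw [hc.exists_bead_iff]
  have h1 := (hc.exists_bead_iff _).1 ⟨j, rfl⟩
  have h2 := hx.apply_add_mul (x.symm (bead c j)) (-1)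
  rw [Equiv.apply_symm_apply] at h2
  have h3 : bead c j - (k + 1) = bead c j + -1 * (k + 1) := by ring
  rw [h3, ← h2, Equiv.symm_apply_apply]
  omega

/-- In each residue class of values the gaps begin at the single `x q` with `1 ≤ q ≤ k + 1` and
continue upwards in steps of `k + 1`. The class therefore has a gap among the `k + 1` integers below
the bead exactly when `x q` is below the bead. -/
theorem IsCoreOfPerm.shortHooks_eq {k : ℕ} {x : Equiv.Perm ℤ} (hx : IsPeriodic k x)
    {c : YoungDiagram} (hc : IsCoreOfPerm x c) (j : ℕ) :
    shortHooks k c j = ((Finset.Icc (1 : ℤ) (k + 1)).filter fun q => x q < bead c j).card := by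
  set s := bead c j with hs
  rw [shortHooks_eq_card_gaps ((Finset.Ico (s - (k + 1)) s).filter fun z => 0 < x.symm z)
    (fun z => by rw [Finset.mem_filter, hc.exists_gap_iff])]
  symm
  have hN : (0 : ℤ) < k + 1 := by positivity
  -- The bijection translates `x q` by the multiple of `k + 1` that brings it into `[s - (k + 1),
  -- s)`.
  refine Finset.card_bij (fun q _ => x q + -((x q - (s - (k + 1))) / (k + 1)) * (k + 1)) ?_ ?_ ?_
  · intro q hq
    rw [Finset.mem_filter, Finset.mem_Icc] at hq
    have h1 := Int.emod_nonneg (x q - (s - (k + 1))) hN.ne'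
    have h2 := Int.emod_lt_of_pos (x q - (s - (k + 1))) hN
    have h3 := Int.emod_add_mul_ediv (x q - (s - (k + 1))) (k + 1)
    rw [mul_comm] at h3
    set t := (x q - (s - (k + 1))) / (k + 1)
    rw [Finset.mem_filter, Finset.mem_Ico, ← hx.apply_add_mul, Equiv.symm_apply_apply,
      hx.apply_add_mul, neg_mul]
    refine ⟨⟨by omega, by omega⟩, ?_⟩
    have h4 : t < 1 := by
      by_contra h4
      have : (k + 1 : ℤ) ≤ t * (k + 1) := le_mul_of_one_le_left hN.le (by omega)
      omega
    have h5 : t * (k + 1 : ℤ) ≤ 0 := mul_nonpos_of_nonpos_of_nonneg (by omega) hN.le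
    omega
  · intro q hq q' hq' h
    rw [Finset.mem_filter, Finset.mem_Icc] at hq hq'
    simp only [← hx.apply_add_mul] at h
    have h1 := x.injective h
    set t := -((x q - (s - (k + 1))) / (k + 1))
    set t' := -((x q' - (s - (k + 1))) / (k + 1))
    have h2 : (t' - t) * (k + 1 : ℤ) = q - q' := by linarith
    have h3 : t' - t < 1 := by nlinarith
    have h4 : -1 < t' - t := by nlinarith
    obtain h5 : t' - t = 0 := by omega
    rw [h5] at h2
    omega
  · intro z hz
    rw [Finset.mem_filter, Finset.mem_Ico] at hz
    obtain ⟨⟨hz1, hz2⟩, hz3⟩ := hz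
    have h1 := Int.emod_nonneg (x.symm z - 1) hN.ne'
    have h2 := Int.emod_lt_of_pos (x.symm z - 1) hN
    have h3 := Int.emod_add_mul_ediv (x.symm z - 1) (k + 1)
    rw [mul_comm] at h3
    have ht : 0 ≤ (x.symm z - 1) / (k + 1) := Int.ediv_nonneg (by omega) hN.le
    set q := (x.symm z - 1) % (k + 1) + 1 with hq
    set t := (x.symm z - 1) / (k + 1)
    have hxq : x q + t * (k + 1) = z := by
      rw [← hx.apply_add_mul, show q + t * (k + 1) = x.symm z by omega, Equiv.apply_symm_apply]
    have ht' : 0 ≤ t * (k + 1 : ℤ) := mul_nonneg ht hN.le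
    refine ⟨q, ?_, ?_⟩
    · rw [Finset.mem_filter, Finset.mem_Icc]
      exact ⟨⟨by omega, by omega⟩, by omega⟩
    · have h4 : (x q - (s - (k + 1))) / (k + 1) = -t := by
        have h5 : x q - (s - (k + 1)) = (z - (s - (k + 1))) + (-t) * (k + 1) := by
          rw [← hxq]; ring
        rw [h5, Int.add_mul_ediv_right _ _ hN.ne', Int.ediv_eq_zero_of_lt (by omega) (by omega),
          zero_add]
      rw [h4, neg_neg, hxq]

/-- A descent is allowed only at multiples of `k + 1`, and none of `1, …, k` is one. -/
theorem strictMonoOn_window {k : ℕ} {x : Equiv.Perm ℤ} (hdom : IsDominant k 0 x) :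
    StrictMonoOn x (Set.Icc 1 (k + 1)) := by
  refine strictMonoOn_of_lt_add_one Set.ordConnected_Icc fun n _ h1 h2 => ?_
  rw [Set.mem_Icc] at h1 h2
  by_contra h
  have h3 : x (n + 1) < x n := lt_of_le_of_ne (not_lt.1 h) fun h' => by simpa using x.injective h'
  have h4 : (n : ZMod (k + 1)) = 0 := hdom ⟨n, rfl, h3⟩
  rw [ZMod.intCast_zmod_eq_zero_iff_dvd] at h4
  have := Int.le_of_dvd (by omega) h4
  push_cast at this
  omega

/-- The window values increase, so those below a bead form an initial segment of the window. -/
theorem lt_shortHooks_iff {k : ℕ} {x : Equiv.Perm ℤ} (hx : IsPeriodic k x) (hdom : IsDominant k 0 x)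
    {c : YoungDiagram} (hc : IsCoreOfPerm x c) {i : ℕ} (hi : i ≤ k) (j : ℕ) :
    i < shortHooks k c j ↔ x (i + 1) < bead c j := by
  have hmono := strictMonoOn_window hdom
  rw [hc.shortHooks_eq hx]
  constructor
  · intro h
    by_contra h1
    have h2 : ((Finset.Icc (1 : ℤ) (k + 1)).filter fun q => x q < bead c j) ⊆
        Finset.Icc (1 : ℤ) i := by
      intro q hq
      rw [Finset.mem_filter, Finset.mem_Icc] at hq
      rw [Finset.mem_Icc]
      refine ⟨hq.1.1, ?_⟩
      by_contra h3
      have := hmono.monotoneOn (a := (i : ℤ) + 1) (b := q) ⟨by omega, by omega⟩ hq.1 (by omega)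
      omega
    have := Finset.card_le_card h2
    rw [Int.card_Icc] at this
    omega
  · intro h
    have h2 : Finset.Icc (1 : ℤ) (i + 1) ⊆
        ((Finset.Icc (1 : ℤ) (k + 1)).filter fun q => x q < bead c j) := by
      intro q hq
      rw [Finset.mem_Icc] at hq
      rw [Finset.mem_filter, Finset.mem_Icc]
      refine ⟨⟨hq.1, by omega⟩, lt_of_le_of_lt ?_ h⟩
      exact hmono.monotoneOn (a := q) (b := (i : ℤ) + 1) ⟨by omega, by omega⟩ ⟨by omega, by omega⟩ hq.2
    have := Finset.card_le_card h2
    rw [Int.card_Icc] at this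
    omega

theorem invCount_window {k : ℕ} {x : Equiv.Perm ℤ} (hdom : IsDominant k 0 x) {q : ℤ}
    (hq : q ∈ Set.Icc (1 : ℤ) (k + 1)) : invCount x q = {p | p ≤ 0 ∧ x q < x p}.ncard := by
  rw [invCount]
  congr 1
  ext p
  constructor
  · rintro ⟨h1, h2⟩
    refine ⟨?_, h2⟩
    by_contra h3
    exact h2.not_ge ((strictMonoOn_window hdom).monotoneOn
      ⟨by omega, by have := hq.2; omega⟩ hq h1.le)
  · rintro ⟨h1, h2⟩
    exact ⟨by have := hq.1; omega, h2⟩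

/-- The inversion code of a Grassmannian permutation records the column heights of its bounded
partition. -/
theorem decCode_eq_colCode {k : ℕ} {x : Equiv.Perm ℤ} (hx : IsPeriodic k x) (hdom : IsDominant k 0 x)
    {c lam : YoungDiagram} (hc : IsCoreOfPerm x c) (hlam : IsCoreOf k c lam) :
    decCode k x = colCode k lam := by
  funext r
  have hr : r + 1 = (((r.val : ℤ) + 1 : ℤ) : ZMod (k + 1)) := by simp
  have hlt := ZMod.val_lt r
  rw [decCode, hr, invCode_intCast hx, colCode,
    invCount_window hdom ⟨by omega, by omega⟩]
  split_ifs with h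
  · have : {p | p ≤ 0 ∧ x ((r.val : ℤ) + 1) < x p} =
        (fun j => x.symm (bead c j)) '' ((Finset.range (lam.colLen r.val) : Finset ℕ) : Set ℕ) := by
      ext p
      have hiff : ∀ j, j < lam.colLen r.val ↔ x ((r.val : ℤ) + 1) < bead c j := fun j => by
        rw [← YoungDiagram.mem_iff_lt_colLen, YoungDiagram.mem_iff_lt_rowLen,
          (isCoreOf_iff.1 hlam).2, lt_shortHooks_iff hx hdom hc h.le]
      constructor
      · rintro ⟨h1, h2⟩
        obtain ⟨j, hj⟩ := (hc.exists_bead_iff (x p)).2 (by simpa using h1)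
        refine ⟨j, ?_, by simp [hj]⟩
        rw [Finset.mem_coe, Finset.mem_range, hiff, hj]
        exact h2
      · rintro ⟨j, hj, rfl⟩
        rw [Finset.mem_coe, Finset.mem_range, hiff] at hj
        refine ⟨(hc.exists_bead_iff _).1 ⟨j, rfl⟩, ?_⟩
        rwa [Equiv.apply_symm_apply]
    rw [this, Set.ncard_image_of_injective (f := fun j => x.symm (bead c j)) _
        (x.symm.injective.comp (bead_strictAnti c).injective),
      Set.ncard_coe_finset, Finset.card_range]
  · have : r.val = k := by omega
    -- `x (k + 1)` is the largest window value, and every value at a nonpositive position is a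
    -- window value lowered by a positive multiple of `k + 1`.
    have hempty : {p | p ≤ 0 ∧ x ((r.val : ℤ) + 1) < x p} = ∅ := by
      rw [this]
      refine Set.eq_empty_iff_forall_notMem.2 fun p ⟨h1, h2⟩ => ?_
      have hN : (0 : ℤ) < k + 1 := by positivity
      have e1 := Int.emod_nonneg (p - 1) hN.ne'
      have e2 := Int.emod_lt_of_pos (p - 1) hN
      have e3 := Int.emod_add_mul_ediv (p - 1) (k + 1)
      rw [mul_comm] at e3
      have e4 : (p - 1) / (k + 1) < 0 := Int.ediv_neg_of_neg_of_pos (by omega) hN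
      set q := (p - 1) % (k + 1) + 1
      set t := (p - 1) / ((k : ℤ) + 1)
      rw [show p = q + t * (k + 1) by omega, hx.apply_add_mul] at h2
      have e5 : t * (k + 1 : ℤ) < 0 := mul_neg_of_neg_of_pos e4 hN
      have e6 := (strictMonoOn_window hdom).monotoneOn (a := q) (b := (k : ℤ) + 1)
        ⟨by omega, by omega⟩ ⟨by omega, by omega⟩ (by omega)
      omega
    rw [hempty, Set.ncard_empty]

/-! ### Existence of the core -/

section
variable {k : ℕ} [NeZero k]

/-- The bead set of a product of generators has charge zero. -/
theorem exists_charge_wordProd (w : List (ZMod (k + 1))) :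
    ∃ M : ℤ, ∀ v ≤ M, ({p | p < 1 ∧ v < wordProd k w p}.ncard : ℤ) = -v := by
  induction w using List.reverseRecOn with
  | nil =>
    refine ⟨0, fun v hv => ?_⟩
    have : {p : ℤ | p < 1 ∧ v < wordProd k [] p} = (Finset.Ioc v 0 : Finset ℤ) := by
      ext p
      simp only [wordProd, List.map_nil, List.prod_nil, Equiv.Perm.one_apply, Finset.coe_Ioc,
        Set.mem_Ioc, Set.mem_ofPred_eq]
      omega
    rw [this, Set.ncard_coe_finset, Int.card_Ioc]
    omega
  | append_singleton w i ih =>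
    obtain ⟨M, hM⟩ := ih
    set y := wordProd k w with hy
    have hyp : IsPeriodic k y := isPeriodic_wordProd w
    rw [wordProd_append, wordProd_singleton, ← hy]
    by_cases hi : i = 0
    · subst hi
      -- Only `s_0` alters the bead set, trading `y 0` for `y 1`; below both values the count does
      -- not notice.
      refine ⟨min M (min (y 0 - 1) (y 1 - 1)), fun v hv => ?_⟩
      have h0 : (y * simple k 0) 0 = y 1 := by
        rw [Equiv.Perm.mul_apply, simple_apply_left (by simp), zero_add]
      have h1 : v < y 0 := by omega
      have h2 : v < y 1 := by omega
      rw [← hM v (by omega), ← zero_add (1 : ℤ), setOf_lt_add_one, setOf_lt_add_one, h0, if_pos h1,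
        if_pos h2, Set.ncard_insert_of_notMem (by simp) (finite_inversions hyp _ _),
        Set.ncard_insert_of_notMem (by simp)
          (finite_inversions (hyp.mul (isPeriodic_simple _)) _ _),
        ncard_mul_simple y (by simpa using (one_ne_zero_zmod (k := k)).symm)]
    · refine ⟨M, fun v hv => ?_⟩
      rw [ncard_mul_simple y (by simpa using fun h => hi h), hM v hv]

/-- List the beads in decreasing order. Charge zero makes the `m`-th bead equal to `-m` for large
`m`, so the differences bead plus index are weakly decreasing and eventually zero: they are the row
lengths. -/
theorem exists_isCoreOfPerm {x : Equiv.Perm ℤ} (hx : IsAffinePerm k x) :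
    ∃ c, IsCoreOfPerm x c := by
  obtain ⟨-, ws, -, hw, -⟩ := exists_decRows_words hx
  obtain ⟨M, hM⟩ := exists_charge_wordProd (k := k) ws.reverse.flatten
  rw [hw] at hM
  obtain ⟨C', hC'⟩ := exists_disp_bound hx.isPeriodic
  obtain ⟨C, hCC⟩ : ∃ C : ℕ, C' ≤ C := ⟨C'.toNat, Int.self_le_toNat _⟩
  have hC : ∀ n, x n ≤ n + C ∧ n - C ≤ x n := fun n => by
    have := abs_le.1 (hC' n)
    omega
  -- Values are counted downwards from the bound `C`, above which there are no beads, so that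
  -- `Nat.nth` lists the beads in decreasing order.
  let P : ℕ → Prop := fun n => x.symm (C - n) ≤ 0
  have hP : ∀ n, 2 * C ≤ n → P n := fun n hn => by
    have := (hC (x.symm (C - n))).2
    rw [Equiv.apply_symm_apply] at this
    change x.symm (C - n) ≤ 0
    omega
  have hinf : (Set.ofPred P).Infinite :=
    Set.infinite_of_not_bddAbove fun ⟨b, hb⟩ => by
      have := hb (hP (2 * C + b + 1) (by omega))
      omega
  have hcount : ∀ m : ℕ, M ≥ -m → Nat.count P (C + m) = m := fun m hm => by
    have h1 := hM (-m) hm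
    rw [neg_neg, Nat.cast_inj] at h1
    rw [Nat.count_eq_card_filter_range, ← h1, ← Set.ncard_coe_finset,
      ← Set.ncard_image_of_injective (f := fun n : ℕ => x.symm (C - n)) _ (fun a b h => by
        have := x.symm.injective h
        omega)]
    congr 1
    ext p
    constructor
    · rintro ⟨n, hn, rfl⟩
      rw [Finset.mem_coe, Finset.mem_filter, Finset.mem_range] at hn
      have h2 : x.symm (C - n) ≤ 0 := hn.2
      refine ⟨by simp only; omega, ?_⟩
      simp only [Equiv.apply_symm_apply]
      omega
    · rintro ⟨h2, h3⟩
      have h4 := (hC p).1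
      have h5 : ((C : ℤ) - ((C - x p).toNat : ℤ)) = x p := by omega
      refine ⟨(C - x p).toNat, ?_, by simp only [h5, Equiv.symm_apply_apply]⟩
      rw [Finset.mem_coe, Finset.mem_filter, Finset.mem_range]
      refine ⟨by omega, ?_⟩
      change x.symm _ ≤ 0
      rw [h5, Equiv.symm_apply_apply]
      omega
  have hnth : ∀ m : ℕ, M ≥ -m → C ≤ m → Nat.nth P m = C + m := fun m hm hm' => by
    have := Nat.nth_count (hP (C + m) (by omega))
    rwa [hcount m hm] at this
  have hmono := Nat.nth_strictMono hinf
  -- Consecutive indices of `Nat.nth` differ by at least one, so the bound at large indices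
  -- propagates back; it keeps the truncated subtraction below exact.
  have hle : ∀ j, Nat.nth P j ≤ C + j := fun j => by
    have h1 := hmono.add_le_nat (C + (-M).toNat) j
    rw [hnth (C + (-M).toNat + j) (by omega) (by omega)] at h1
    omega
  have hanti : Antitone fun j => C + j - Nat.nth P j :=
    antitone_nat_of_succ_le fun j => by
      have := hmono (Nat.lt_add_one j)
      omega
  obtain ⟨c, hc⟩ := exists_youngDiagram hanti (J := max C (-M).toNat)
    (by rw [hnth _ (by omega) (le_max_left _ _)]; omega)
  refine ⟨c, ?_⟩
  have hb : (fun i : ℕ => (c.rowLen i : ℤ) - i) = fun i => (C : ℤ) - Nat.nth P i := by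
    funext i
    rw [hc]
    have := hle i
    omega
  rw [IsCoreOfPerm, hb, Equiv.image_eq_preimage_symm]
  ext z
  constructor
  · intro hz
    have h1 : x.symm z ≤ 0 := hz
    have h2 := (hC (x.symm z)).1
    rw [Equiv.apply_symm_apply] at h2
    have h3 : (C - z).toNat ∈ Set.range (Nat.nth P) := by
      rw [Nat.range_nth_of_infinite hinf]
      change x.symm _ ≤ 0
      rwa [show ((C : ℤ) - ((C - z).toNat : ℤ)) = z by omega]
    obtain ⟨i, hi⟩ := h3
    exact ⟨i, by simp only; omega⟩
  · rintro ⟨i, rfl⟩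
    exact Nat.nth_mem_of_infinite hinf i

end

/-! ### The reflection exchanging decreasing and increasing expressions -/

/-- The reflection `n ↦ 1 - n`. -/
def reflect : Equiv.Perm ℤ := Equiv.subLeft 1

/-- Conjugation by the reflection `n ↦ 1 - n`. -/
def conjReflect (x : Equiv.Perm ℤ) : Equiv.Perm ℤ := reflect * x * reflect

theorem conjReflect_apply (x : Equiv.Perm ℤ) (n : ℤ) : conjReflect x n = 1 - x (1 - n) := rfl

theorem conjReflect_conjReflect (x : Equiv.Perm ℤ) : conjReflect (conjReflect x) = x := by
  ext n
  simp [conjReflect_apply]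

theorem conjReflect_mul (x y : Equiv.Perm ℤ) :
    conjReflect (x * y) = conjReflect x * conjReflect y := by
  ext n
  simp [conjReflect_apply]

theorem conjReflect_simple {k : ℕ} [NeZero k] (i : ZMod (k + 1)) :
    conjReflect (simple k i) = simple k (-i) := by
  ext n
  have h1 : ((1 - n : ℤ) : ZMod (k + 1)) = i ↔ (n : ZMod (k + 1)) = -i + 1 := by
    push_cast
    constructor <;> intro h
    · rw [← h]; ring
    · rw [h]; ring
  have h2 : ((1 - n : ℤ) : ZMod (k + 1)) = i + 1 ↔ (n : ZMod (k + 1)) = -i := by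
    push_cast
    constructor <;> intro h
    · linear_combination -h
    · rw [h]; ring
  have h3 : -i ≠ -i + 1 := ne_add_one_zmod _
  rw [conjReflect_apply, simple_apply, simple_apply]
  simp only [h1, h2]
  split_ifs with h4 h5 h5
  · exact absurd (h5.symm.trans h4) h3
  · ring
  · ring
  · ring

theorem conjReflect_wordProd {k : ℕ} [NeZero k] (w : List (ZMod (k + 1))) :
    conjReflect (wordProd k w) = wordProd k (w.map Neg.neg) := by
  induction w with
  | nil =>
    ext n
    simp [wordProd, conjReflect_apply]
  | cons i w ih =>
    rw [← List.singleton_append, wordProd_append, conjReflect_mul, ih, wordProd_singleton,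
      conjReflect_simple, List.map_append, wordProd_append, List.map_singleton, wordProd_singleton]

theorem wordProd_map_neg {k : ℕ} [NeZero k] (x : Equiv.Perm ℤ) (w : List (ZMod (k + 1))) :
    wordProd k (w.map Neg.neg) = conjReflect x ↔ wordProd k w = x := by
  rw [← conjReflect_wordProd]
  exact (Function.LeftInverse.injective conjReflect_conjReflect).eq_iff

theorem map_neg_map_neg {k : ℕ} (w : List (ZMod (k + 1))) :
    (w.map Neg.neg).map Neg.neg = w := by
  simp

theorem isReducedWord_map_neg {k : ℕ} [NeZero k] (x : Equiv.Perm ℤ) (w : List (ZMod (k + 1))) :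
    IsReducedWord k (conjReflect x) (w.map Neg.neg) ↔ IsReducedWord k x w := by
  rw [IsReducedWord, IsReducedWord, wordProd_map_neg]
  refine and_congr_right fun _ => ⟨fun h w' hw' => ?_, fun h w' hw' => ?_⟩
  · simpa using h (w'.map Neg.neg) ((wordProd_map_neg x w').2 hw')
  · rw [← map_neg_map_neg w', wordProd_map_neg] at hw'
    simpa using h _ hw'

theorem idxOf_map_of_injective {α β : Type*} [DecidableEq α] [DecidableEq β] {f : α → β}
    (hf : Function.Injective f) (l : List α) (a : α) : (l.map f).idxOf (f a) = l.idxOf a := by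
  induction l with
  | nil => rfl
  | cons b l ih =>
    have : (f b == f a) = (b == a) := by rw [Bool.eq_iff_iff, beq_iff_eq, beq_iff_eq, hf.eq_iff]
    rw [List.map_cons, List.idxOf_cons, List.idxOf_cons, ih, this]

/-- Negation turns the pair `j - 1, j` into `-j + 1, -j`, which reverses the cyclic order condition.
-/
theorem isIncWord_iff {k : ℕ} {A : Finset (ZMod (k + 1))} {w : List (ZMod (k + 1))} :
    IsIncWord k A w ↔ IsDecWord k (A.image Neg.neg) (w.map Neg.neg) := by
  have hinj : Function.Injective (Neg.neg : ZMod (k + 1) → ZMod (k + 1)) := neg_injective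
  have hmem : ∀ j, j ∈ A.image Neg.neg ↔ -j ∈ A := fun j => by simp [neg_eq_iff_eq_neg]
  refine and_congr (List.nodup_map_iff hinj).symm (and_congr ?_ ?_)
  · have h : (w.map Neg.neg).toFinset = w.toFinset.image Neg.neg := by
      ext j
      simp
    rw [h, (Finset.image_injective hinj).eq_iff]
  · have h1 : ∀ j, (w.map Neg.neg).idxOf j = w.idxOf (-j) := fun j => by
      rw [← idxOf_map_of_injective hinj w, neg_neg]
    simp only [hmem, h1]
    constructor
    · intro h j hj hj'
      have := h (-(j - 1)) hj' (by rwa [show -(j - 1) - 1 = -j by ring])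
      rwa [show -(j - 1) - 1 = -j by ring] at this
    · intro h j hj hj'
      have := h (-(j - 1)) (by rwa [neg_neg]) (by rwa [show -(-(j - 1) - 1) = j by ring])
      rwa [show -(-(j - 1) - 1) = j by ring, neg_neg] at this

/-- Negation of all residues in a list of sets. -/
def negRows {k : ℕ} (A : List (Finset (ZMod (k + 1)))) : List (Finset (ZMod (k + 1))) :=
  A.map fun S => S.image Neg.neg

theorem negRows_negRows {k : ℕ} (A : List (Finset (ZMod (k + 1)))) : negRows (negRows A) = A := by
  simp [negRows, Function.comp_def, Finset.image_image]

theorem shape_negRows {k : ℕ} (A : List (Finset (ZMod (k + 1)))) : shape (negRows A) = shape A := by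
  simp [negRows, shape, Function.comp_def, Finset.card_image_of_injective _ neg_injective]

theorem isIncExpr_iff {k : ℕ} [NeZero k] (x : Equiv.Perm ℤ) (A : List (Finset (ZMod (k + 1)))) :
    IsIncExpr k x A ↔ IsDecExpr k (conjReflect x) (negRows A) := by
  have hinv : ∀ S : Finset (ZMod (k + 1)), (S.image Neg.neg).image Neg.neg = S := fun S => by
    simp [Finset.image_image]
  have hu : (Finset.univ : Finset (ZMod (k + 1))).image Neg.neg = Finset.univ :=
    Finset.image_univ_of_surjective neg_surjective
  refine and_congr ?_ ?_
  · rw [negRows, List.forall_mem_map]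
    refine forall₂_congr fun S _ => and_congr Finset.image_nonempty.symm (not_congr ?_)
    constructor
    · rintro rfl
      exact hu
    · intro h
      rw [← hinv S, h, hu]
  · have hflat : ∀ ws : List (List (ZMod (k + 1))),
        (ws.map (List.map Neg.neg)).reverse.flatten = ws.reverse.flatten.map Neg.neg := fun ws => by
      rw [← List.map_reverse, List.map_flatten]
    constructor
    · rintro ⟨ws, h1, h2⟩
      refine ⟨ws.map (List.map Neg.neg), ?_, ?_⟩
      · rw [negRows, List.forall₂_map_left_iff, List.forall₂_map_right_iff]
        exact h1.imp fun _ _ => isIncWord_iff.1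
      · rwa [hflat, isReducedWord_map_neg]
    · rintro ⟨ws, h1, h2⟩
      have hws : (ws.map (List.map Neg.neg)).map (List.map Neg.neg) = ws := by
        simp
      rw [← hws] at h1 h2
      refine ⟨ws.map (List.map Neg.neg), ?_, ?_⟩
      · rw [negRows, List.forall₂_map_left_iff, List.forall₂_map_right_iff] at h1
        exact h1.imp fun _ _ => isIncWord_iff.2
      · rwa [hflat, isReducedWord_map_neg] at h2

theorem isMaxIncExpr_iff {k : ℕ} [NeZero k] (x : Equiv.Perm ℤ) (A : List (Finset (ZMod (k + 1)))) :
    IsMaxIncExpr k x A ↔ IsMaxDecExpr k (conjReflect x) (negRows A) := by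
  refine and_congr (isIncExpr_iff x A) ⟨fun h B hB => ?_, fun h B hB => ?_⟩
  · rw [← negRows_negRows B, ← isIncExpr_iff] at hB
    have := h _ hB
    rwa [shape_negRows] at this ⊢
  · have := h _ ((isIncExpr_iff x B).1 hB)
    rwa [shape_negRows, shape_negRows] at this

theorem incRows_neg {k : ℕ} (β : ZMod (k + 1) → ℕ) :
    incRows k (fun i => β (-i)) = negRows (decRows k β) := by
  have hsup : Finset.univ.sup (fun i => β (-i)) = Finset.univ.sup β := by
    refine le_antisymm (Finset.sup_le fun i _ => Finset.le_sup (f := β) (Finset.mem_univ (-i)))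
      (Finset.sup_le fun i _ => ?_)
    have := Finset.le_sup (f := fun i => β (-i)) (Finset.mem_univ (-i))
    simpa only [neg_neg] using this
  rw [incRows, decRows, negRows, List.map_map, hsup]
  refine List.map_congr_left fun j _ => ?_
  ext r
  simp only [Function.comp, Finset.mem_image, Finset.mem_filter_univ]
  constructor
  · rintro ⟨i, hi, rfl⟩
    exact ⟨-i - j, ⟨-i, hi, rfl⟩, by ring⟩
  · rintro ⟨_, ⟨i, hi, rfl⟩, rfl⟩
    exact ⟨-i, by rwa [neg_neg], by ring⟩

theorem IsRD.isRI_neg {k : ℕ} [NeZero k] {x : Equiv.Perm ℤ} {β : ZMod (k + 1) → ℕ}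
    (h : IsRD k (conjReflect x) β) : IsRI k x (fun i => β (-i)) := by
  obtain ⟨⟨i, hi⟩, h2⟩ := h
  refine ⟨⟨-i, by simpa only [neg_neg] using hi⟩, fun A => ?_⟩
  rw [isMaxIncExpr_iff, h2, incRows_neg]
  exact ⟨fun h => by rw [← h, negRows_negRows], fun h => by rw [h, negRows_negRows]⟩

theorem IsPeriodic.conjReflect {k : ℕ} {x : Equiv.Perm ℤ} (hx : IsPeriodic k x) :
    IsPeriodic k (conjReflect x) := by
  intro n
  have := hx (1 - (n + (k + 1)))
  rw [show (1 - (n + (k + 1)) + (k + 1) : ℤ) = 1 - n by ring] at this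
  rw [conjReflect_apply, conjReflect_apply]
  omega

theorem IsAffinePerm.conjReflect {k : ℕ} {x : Equiv.Perm ℤ} (hx : IsAffinePerm k x) :
    IsAffinePerm k (conjReflect x) := by
  rw [isAffinePerm_iff] at hx ⊢
  refine ⟨hx.1.conjReflect, ?_⟩
  have h : ∀ r, disp k (AffineCode.conjReflect x) r = -disp k x (1 - r) := by
    intro r
    obtain ⟨n, rfl⟩ := ZMod.intCast_surjective r
    have : (1 - (n : ZMod (k + 1))) = ((1 - n : ℤ) : ZMod (k + 1)) := by push_cast; rfl
    rw [this, disp_intCast hx.1, disp_intCast hx.1.conjReflect, conjReflect_apply]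
    ring
  have hsum : ∑ r, disp k x (1 - r) = ∑ r, disp k x r :=
    Equiv.sum_comp (Equiv.subLeft (1 : ZMod (k + 1))) (disp k x)
  rw [Finset.sum_congr rfl fun r _ => h r, Finset.sum_neg_distrib, hsum, hx.2, neg_zero]

theorem IsDominant.conjReflect {k : ℕ} {x : Equiv.Perm ℤ} (hdom : IsDominant k 0 x) :
    IsDominant k 0 (conjReflect x) := by
  rintro _ ⟨n, rfl, h⟩
  rw [conjReflect_apply, conjReflect_apply, show 1 - (n + 1) = -n by ring] at h
  have : ((-n : ℤ) : ZMod (k + 1)) = 0 :=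
    hdom ⟨-n, rfl, by rw [show -n + 1 = 1 - n by ring]; omega⟩
  push_cast at this
  exact neg_eq_zero.1 this

/-- The reflection carries positive positions to nonpositive ones, hence gaps of `c` to beads, and
the beads of the transpose are the reflected gaps. -/
theorem IsCoreOfPerm.conjReflect {x : Equiv.Perm ℤ} {c : YoungDiagram} (hc : IsCoreOfPerm x c) :
    IsCoreOfPerm (conjReflect x) c.transpose := by
  have h : Set.range (bead c.transpose) = AffineCode.conjReflect x '' Set.Iic 0 := by
    ext z
    have h1 := hc.exists_gap_iff (1 - z)
    constructor
    · rintro ⟨j, rfl⟩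
      rw [bead_transpose] at h1 ⊢
      have h2 := h1.1 ⟨j, by ring⟩
      refine ⟨1 - x.symm (1 - (1 - gap c j)), ?_, ?_⟩
      · rw [Set.mem_Iic]; omega
      · rw [conjReflect_apply, sub_sub_cancel, Equiv.apply_symm_apply]
        ring
    · rintro ⟨p, hp, rfl⟩
      rw [conjReflect_apply] at h1 ⊢
      rw [Set.mem_Iic] at hp
      obtain ⟨m, hm⟩ := h1.2 (by rw [sub_sub_cancel, Equiv.symm_apply_apply]; omega)
      exact ⟨m, by rw [bead_transpose, hm]; ring⟩
  exact h.symm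

end AffineCode

/-! ### Assembling the two maximal decompositions -/

theorem mainTheorem9 (k : ℕ) [NeZero k] (x : Equiv.Perm ℤ)
    (hx : AffineCode.IsAffinePerm k x) (hdom : AffineCode.IsDominant k 0 x) :
    (∃! lam : YoungDiagram, AffineCode.IsBounded k lam ∧ AffineCode.IsAssociated k x lam) ∧
    ∀ lam : YoungDiagram, AffineCode.IsBounded k lam → AffineCode.IsAssociated k x lam →
      AffineCode.IsRD k x (AffineCode.colCode k lam) ∧
      (∃! nu : YoungDiagram, AffineCode.IsBounded k nu ∧ AffineCode.IsKConjugate k lam nu) ∧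
      ∀ nu : YoungDiagram, AffineCode.IsBounded k nu → AffineCode.IsKConjugate k lam nu →
        AffineCode.IsRI k x (fun i => AffineCode.colCode k nu (-i)) := by
  obtain ⟨c, hc⟩ := AffineCode.exists_isCoreOfPerm hx
  have hcore := hc.isCore hx.isPeriodic
  refine ⟨?_, ?_⟩
  · obtain ⟨lam, hb, hlam⟩ := hcore.exists_isCoreOf
    refine ⟨lam, ⟨hb, c, hlam, hc⟩, ?_⟩
    rintro mu ⟨-, d, hmu, hd⟩
    obtain rfl := hc.core_unique hd
    exact hmu.partition_unique hlam
  · rintro lam - ⟨d, hlam, hd⟩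
    obtain rfl := hc.core_unique hd
    refine ⟨?_, ?_, ?_⟩
    · rw [← AffineCode.decCode_eq_colCode hx.isPeriodic hdom hc hlam]
      exact AffineCode.isRD_decCode hx
    · obtain ⟨nu, hb, hnu⟩ := hcore.transpose.exists_isCoreOf
      refine ⟨nu, ⟨hb, c, hlam, hnu⟩, ?_⟩
      rintro mu ⟨-, e, he, hmu⟩
      obtain rfl := hlam.core_unique he
      exact hmu.partition_unique hnu
    · rintro nu - ⟨e, he, hnu⟩
      obtain rfl := hlam.core_unique he
      refine AffineCode.IsRD.isRI_neg ?_
      rw [← AffineCode.decCode_eq_colCode hx.isPeriodic.conjReflect hdom.conjReflect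
        hc.conjReflect hnu]
      exact AffineCode.isRD_decCode hx.conjReflect
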